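/- Let $d\ge 1$, $A\ge 0$ be integers and $n=d+1$. For $m:\mathbb R^d\to\mathbb C$ of class $C^A$ on $\mathbb R^d\setminus\{0\}$ put $\|m\|_{\mathcal M_A(d)}=\sup_{|\alpha|\le A}\sup_{\eta\ne 0}|\eta|^{|\alpha|}|D^\alpha m(\eta)|$ (and $\|m\|_{\mathcal M_A(d)}=\infty$ for all other $m$); $\mathcal M_A(d)$ is the set of $m$ with $\|m\|_{\mathcal M_A(d)}<\infty$. Let $\mathbf{Gr}(d,n)$ be the set of oriented hyperplanes $\sigma\subset\mathbb R^n$ through the origin, with orthogonal projections $\Pi_\sigma$, positive unit normals $v_\sigma$, and $\mathrm{dist}(\sigma,\tau)=|v_\sigma-v_\tau|$; let $\mathbb R^d=e_n^\perp\subset\mathbb R^n$. For a family $\mathscr m=\{m_\sigma:\sigma\in\mathbf{Gr}(d,n)\}$ of functions on $\mathbb R^d$ put $$\|\mathscr m\|_{\mathcal M_A(\mathbf{Gr}(d,n))}=\sup_{\sigma,\tau}\Big[\|m_\sigma\|_{\mathcal M_A(d)}+\log\big(e+\tfrac1{\mathrm{dist}(\sigma,\tau)}\big)\|m_\tau-m_\sigma\|_{\mathcal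 M_A(d)}\Big],$$ where the second summand is $0$ for $\sigma=\tau$, and $$T^\star_{\mathscr m}f(x)=\sup_{\sigma}\ \sup_{V\in \mathrm{SO}(n),\,Vv_\sigma=e_n}\Big|\int_{\mathbb R^n}m_\sigma(V\Pi_\sigma\xi)\widehat f(\xi)e^{2\pi i\langle x,\xi\rangle}d\xi\Big|,\qquad x\in\mathbb R^n .$$ Fix a smooth, radial, nonnegative function $\zeta\not\equiv0$ on $\mathbb R^n$ with support in $\{1<|\xi|<\tfrac32\}$ and let $\widehat{P_0f}=\zeta\widehat f$. Write $\|g\|_{L^{2,\infty}}=\sup_{t>0}t\,|\{|g|>t\}|^{1/2}$. **Theorem.** Suppose that the band-limited estimates hold: there are constants $C$ and, for each $2<p<\infty$, $C_p$ such that $$\|T^\star_{\mathscr m}P_0f\|_{L^{2,\infty}(\mathbb R^n)}\le C\|f\|_{L^2(\mathbb R^n)},\qquad \|T^\star_{\mathscr m}P_0f\|_{L^{p}(\mathbb R^n)}\le C_p\|f\|_{L^p(\mathbb R^n)}\quad(2<p<\infty)$$ for all Schwartz functions $f$ and all families with $\|\mathscr m\|_{\mathcal M_A(\mathbf{Gr}(d,n))}\le1$.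 Then the Carleson--Sjölin operator $$\mathsf{CS}[f](x)=\sup_{N\in\mathbb R^d}\Big|\int_{\mathbb R^d}\widehat f(\eta)\,m(\eta+N)\,e^{2\pi i\langle\eta,x\rangle}d\eta\Big|,\qquad x\in\mathbb R^d,$$ maps $L^2(\mathbb R^d)$ to $L^{2,\infty}(\mathbb R^d)$ and $L^p(\mathbb R^d)$ to $L^p(\mathbb R^d)$ for all $2<p<\infty$, for every $m\in\mathcal M_A(d)$. More precisely, there are constants $C'$ and $C'_p$, independent of $m\in\mathcal M_A(d)$ and $f$, such that for all Schwartz functions $f$ $$\|\mathsf{CS}[f]\|_{L^{2,\infty}}\le C'\|m\|_{\mathcal M_A(d)}\|f\|_{L^2},\qquad \|\mathsf{CS}[f]\|_{L^p}\le C'_p\|m\|_{\mathcal M_A(d)}\|f\|_{L^p}\quad(2<p<\infty),$$ and in each case $\mathsf{CS}$ extends from Schwartz functions to a map $S$ on all of $L^2$ (respectively $L^p$), with $S[f]\ge 0$ measurable for each $f$, such that $S[f]$ and $|S[f]-S[g]|$ satisfy the same bounds in terms of $\|f\|$ and $\|f-g\|$. -/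

import Mathlib

open MeasureTheory
open scoped ENNReal NNReal FourierTransform SchwartzMap ContDiff

noncomputable section

namespace CarlesonSjolin

/-- The Euclidean space `ℝᵏ`. -/
abbrev E (k : ℕ) : Type := EuclideanSpace ℝ (Fin k)

open Classical in
/-- The Hörmander--Mihlin norm
`‖m‖_{M_A(d)} = sup_{|α| ≤ A} sup_η |η|^{|α|} |D^α m(η)|`.
The function `m` has to be of class `C^A` off the origin (the norm is `∞` otherwise), and the
supremum is over `η ≠ 0`: a multiplier may be singular at the origin, a null set. The partial
derivatives of order `k` are the values of the `k`-th derivative on `k`-tuples of coordinate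
vectors. -/
def mihlinNorm {d : ℕ} (A : ℕ) (m : E d → ℂ) : ℝ≥0∞ :=
  if ContDiffOn ℝ A m {0}ᶜ then
    ⨆ (k : ℕ) (_ : k ≤ A) (i : Fin k → Fin d) (η : E d) (_ : η ≠ 0),
      ‖η‖ₑ ^ k *
        ‖iteratedFDeriv ℝ k m η (fun j => EuclideanSpace.single (i j) (1 : ℝ))‖ₑ
  else ⊤

/-- The weak `L^p` quasi-norm `sup_{t > 0} t |{g > t}|^{1/p}` of a nonnegative function. -/
def weakNorm {k : ℕ} (p : ℝ) (g : E k → ℝ≥0∞) : ℝ≥0∞ :=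
  ⨆ t : ℝ≥0, (t : ℝ≥0∞) * volume {x | (t : ℝ≥0∞) < g x} ^ (1 / p)

/-- The character `e^{2πi⟨x, ξ⟩}`. -/
def char {k : ℕ} (x ξ : E k) : ℂ :=
  Complex.exp (2 * (Real.pi : ℂ) * Complex.I * ((inner ℝ x ξ : ℝ) : ℂ))

/-! ### Oriented hyperplanes and subspace singular integrals in `ℝ^{d+1}` -/

/-- The oriented Grassmannian `Gr(d, d+1)` in codimension one. The oriented hyperplane `σ` is
identified with its positive unit normal `v_σ`, and the distance is `|v_σ - v_τ|`. -/
abbrev Gr (d : ℕ) : Type := Metric.sphere (0 : E (d + 1)) 1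

/-- The last coordinate vector, the unit normal of `ℝᵈ = span {e_1, …, e_d}`. -/
def eLast (d : ℕ) : E (d + 1) := EuclideanSpace.single (Fin.last d) (1 : ℝ)

/-- The first `d` coordinates of a vector of `ℝ^{d+1}`. -/
def horizontal {d : ℕ} (x : E (d + 1)) : E d := WithLp.toLp 2 (fun i : Fin d => x i.castSucc)

/-- The orthogonal projection `Π_σ` onto the hyperplane `σ`. -/
def projOnto {d : ℕ} (σ : Gr d) (ξ : E (d + 1)) : E (d + 1) :=
  (ℝ ∙ (σ : E (d + 1)))ᗮ.starProjection ξ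

/-- The rotations `V ∈ SO(d+1)` that map the oriented hyperplane `σ` to `ℝᵈ`, that is, the
positive unit normal of `σ` to that of `ℝᵈ`. If `O_σ` is one of them, then these are exactly the
rotations `Q O_σ` with `Q ∈ SO(d)` acting on the first `d` coordinates. -/
def rotationsTo {d : ℕ} (σ : Gr d) : Set (E (d + 1) ≃ₗᵢ[ℝ] E (d + 1)) :=
  {V | LinearMap.det (V.toLinearEquiv : E (d + 1) →ₗ[ℝ] E (d + 1)) = 1 ∧
    V (σ : E (d + 1)) = eLast d}

/-- `∫ m(V Π_σ ξ) f̂(ξ) e^{2πi⟨x, ξ⟩} dξ`. -/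
def subspaceOp {d : ℕ} (m : E d → ℂ) (σ : Gr d) (V : E (d + 1) ≃ₗᵢ[ℝ] E (d + 1))
    (f : E (d + 1) → ℂ) (x : E (d + 1)) : ℂ :=
  ∫ ξ : E (d + 1), m (horizontal (V (projOnto σ ξ))) * 𝓕 f ξ * char x ξ

/-- The maximal operator `T^⋆`: the supremum of `|∫ m_σ(V Π_σ ξ) f̂(ξ) e^{2πi⟨x, ξ⟩} dξ|` over all
oriented hyperplanes `σ` and all rotations `V` that map `σ` to `ℝᵈ`. -/
def maximalOp {d : ℕ} (m : Gr d → E d → ℂ) (f : E (d + 1) → ℂ) (x : E (d + 1)) : ℝ≥0∞ :=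
  ⨆ (σ : Gr d) (V ∈ rotationsTo σ), ‖subspaceOp (m σ) σ V f x‖ₑ

/-- The norm of a family of multipliers `m_σ`, with a logarithmic modulus of continuity in `σ`. -/
def familyNorm {d : ℕ} (A : ℕ) (m : Gr d → E d → ℂ) : ℝ≥0∞ :=
  ⨆ (σ : Gr d) (τ : Gr d), mihlinNorm A (m σ) +
    ENNReal.ofReal (Real.log (Real.exp 1 + 1 / dist σ τ)) *
      mihlinNorm A (fun η => m τ η - m σ η)

/-- A smooth, radial, nonnegative and nontrivial function supported in `{1 < |ξ| < 3/2}`. -/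
structure IsAnnularBump {k : ℕ} (ζ : E k → ℝ) : Prop where
  smooth : ContDiff ℝ ∞ ζ
  radial : ∀ ξ ξ' : E k, ‖ξ‖ = ‖ξ'‖ → ζ ξ = ζ ξ'
  nonneg : ∀ ξ, 0 ≤ ζ ξ
  supp : tsupport ζ ⊆ {ξ | 1 < ‖ξ‖ ∧ ‖ξ‖ < 3 / 2}
  nontrivial : ∃ ξ, ζ ξ ≠ 0

/-- The frequency projection `P_0 f(x) = ∫ ζ(ξ) f̂(ξ) e^{2πi⟨x, ξ⟩} dξ`. -/
def annularProj {k : ℕ} (ζ : E k → ℝ) (f : E k → ℂ) (x : E k) : ℂ :=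
  ∫ ξ : E k, (ζ ξ : ℂ) * 𝓕 f ξ * char x ξ

/-- The band-limited estimates in `ℝ^{d+1}` for the maximal operator `T^⋆ ∘ P_0`, for Schwartz
functions and uniformly over all families of multipliers of norm at most `1`: the weak `(2,2)`
bound, and the strong `(p,p)` bounds for `2 < p < ∞`. -/
def BandLimitedBounds (d A : ℕ) (ζ : E (d + 1) → ℝ) : Prop :=
  (∃ C : ℝ≥0, ∀ m : Gr d → E d → ℂ, familyNorm A m ≤ 1 → ∀ f : 𝓢(E (d + 1), ℂ),
      weakNorm 2 (maximalOp m (annularProj ζ f)) ≤ C * eLpNorm f 2 volume) ∧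
  ∀ p : ℝ, 2 < p → ∃ C : ℝ≥0, ∀ m : Gr d → E d → ℂ, familyNorm A m ≤ 1 →
    ∀ f : 𝓢(E (d + 1), ℂ),
      eLpNorm (maximalOp m (annularProj ζ f)) (ENNReal.ofReal p) volume
        ≤ C * eLpNorm f (ENNReal.ofReal p) volume

/-! ### The Carleson--Sjölin operator on `ℝᵈ` -/

/-- `CS[f](x) = sup_{N ∈ ℝᵈ} |∫ f̂(η) m(η + N) e^{2πi⟨η, x⟩} dη|`. -/
def carlesonSjolin {d : ℕ} (m : E d → ℂ) (f : E d → ℂ) (x : E d) : ℝ≥0∞ :=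
  ⨆ N : E d, ‖∫ η : E d, 𝓕 f η * m (η + N) * char η x‖ₑ

/-- The operator `T`, which is given by an explicit formula on Schwartz functions, maps `L^p` to the
space with (quasi-)norm `ν`, with constant `C`: it has an extension `S` to all of `L^p` that
satisfies `ν(S f) ≤ C ‖f‖_p` and `ν(|S f - S g|) ≤ C ‖f - g‖_p`. As Schwartz functions are dense in
`L^p` for `p < ∞`, the extension is unique up to null sets. -/
def MapsLp {k : ℕ} (T : (E k → ℂ) → E k → ℝ≥0∞) (p : ℝ≥0∞)
    (ν : (E k → ℝ≥0∞) → ℝ≥0∞) (C : ℝ≥0∞) : Prop :=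
  ∃ S : (E k → ℂ) → E k → ℝ≥0,
    (∀ φ : 𝓢(E k, ℂ), ∀ᵐ x, (S φ x : ℝ≥0∞) = T φ x) ∧
    (∀ f, MemLp f p volume → AEMeasurable (S f) volume) ∧
    (∀ f, MemLp f p volume → ν (fun x => (S f x : ℝ≥0∞)) ≤ C * eLpNorm f p volume) ∧
    (∀ f g, MemLp f p volume → MemLp g p volume →
      ν (fun x => edist (S f x) (S g x)) ≤ C * eLpNorm (f - g) p volume)

end CarlesonSjolin

end

/-!
The Carleson--Sjölin operator on `ℝᵈ` is a limit of the maximal subspace operator on `ℝ^{d+1}`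
acting on wave packets of frequency width `ε → 0` centred at the frequency `r e_{d+1}`, where `r` is
chosen so that `ζ(r e_{d+1}) ≠ 0`.

Given a multiplier `m`, take the constant family `m_σ = m(· / ε)`. The log-term of its norm
vanishes, and by dilation invariance its norm is at most that of `m` (`familyNorm_const`,
`mihlinNorm_mul_comp_smul_le`). Given `N ∈ ℝᵈ`, let `V` be a rotation that tilts `e_{d+1}` towards
`N` by an angle of order `ε |N| / r`; such a rotation is a product of two half-turns, and it is
admissible for the hyperplane with normal `V⁻¹ e_{d+1}` (`exists_rotation`). At the frequency
`r e_{d+1} + ε η` the multiplier takes the value `m(η' + N + O(ε))`, where `η'` consists of the first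
`d` coordinates of `η`, so on the wave packet with profile `φ ⊗ g` the rescaled operator converges
to `ζ(r e_{d+1}) g(x_{d+1})` times the Fourier integral of `φ` with multiplier `m(· + N)`
(`tendsto_integral_tilt`). Since `N` is arbitrary, the lower limit of the rescaled maximal
functions dominates `|ζ(r e_{d+1}) g(x_{d+1})|` times the Carleson--Sjölin operator
(`carlesonSjolin_le_liminf_maximalOp`). The band-limited bounds are invariant under the rescaling,
and Fatou's lemma transfers them to `ℝᵈ` (`exists_carlesonSjolin_le`).

The extension to `L^p` uses that the operator is sublinear. Along a sequence of Schwartz functions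
that converges to `f` at a geometric rate the values converge almost everywhere, by the weak type
bound and the Borel--Cantelli lemma, and Fatou's lemma gives the bounds for the limit
(`mapsLp_of_le`).

Both halves are carried out for an abstract quasi-norm (`IsLebesgueQuasinorm`), which covers `L^p`
and weak `L^p`.
-/

namespace CarlesonSjolin

open Filter Topology

/-! ### Splitting off the last coordinate -/

/-- The identification `x ↦ ((x_1, …, x_d), x_{d+1})` of `ℝ^{d+1}` with `ℝᵈ × ℝ`. -/
noncomputable def splitLast (d : ℕ) : E (d + 1) ≃ᵐ E d × ℝ :=
  (((MeasurableEquiv.toLp 2 (Fin (d + 1) → ℝ)).symm.trans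
    (MeasurableEquiv.piFinSuccAbove (fun _ => ℝ) (Fin.last d))).trans
    MeasurableEquiv.prodComm).trans
    ((MeasurableEquiv.toLp 2 (Fin d → ℝ)).prodCongr (MeasurableEquiv.refl ℝ))

theorem splitLast_apply {d : ℕ} (x : E (d + 1)) :
    splitLast d x = (horizontal x, x (Fin.last d)) := by
  have : ∀ i : Fin d, (Fin.last d).succAbove i = i.castSucc := fun i => Fin.succAbove_last_apply i
  simp only [splitLast, horizontal, MeasurableEquiv.trans_apply, Prod.ext_iff]
  refine ⟨?_, rfl⟩
  ext i
  change x ((Fin.last d).succAbove i) = x i.castSucc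
  rw [this]

theorem measurePreserving_splitLast (d : ℕ) :
    MeasurePreserving (splitLast d) volume volume := by
  have h1 := EuclideanSpace.volume_preserving_symm_measurableEquiv_toLp (Fin (d + 1))
  have h2 := volume_preserving_piFinSuccAbove (fun _ : Fin (d + 1) => ℝ) (Fin.last d)
  have h3 : MeasurePreserving (MeasurableEquiv.prodComm : ℝ × (Fin d → ℝ) ≃ᵐ (Fin d → ℝ) × ℝ)
      volume volume := Measure.measurePreserving_swap
  have h4 := (PiLp.volume_preserving_toLp (Fin d)).prod
    (MeasurePreserving.id (volume : Measure ℝ))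
  exact h4.comp (h3.comp (h2.comp h1))

theorem inner_eq_horizontal_add {d : ℕ} (x y : E (d + 1)) :
    (inner ℝ x y : ℝ) = inner ℝ (horizontal x) (horizontal y)
      + x (Fin.last d) * y (Fin.last d) := by
  simp [PiLp.inner_apply, Fin.sum_univ_castSucc, horizontal, mul_comm]

/-! ### Quasi-norms of Lebesgue type -/

/-- The properties shared by the norm of `L^p` and the quasi-norm of weak `L^p` that make the
transference and extension arguments work. Here `ν k` acts on nonnegative functions on `ℝᵏ`. The
condition `slab` compares `G` with the function on `ℝ^{k+1}` that is `G(x_1, …, x_k)` for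
`x_{k+1} ∈ [0, 1]` and `0` elsewhere. -/
structure IsLebesgueQuasinorm (p : ℝ) (ν : ∀ k : ℕ, (E k → ℝ≥0∞) → ℝ≥0∞) : Prop where
  mono : ∀ {k : ℕ} {G H : E k → ℝ≥0∞}, (∀ᵐ x, G x ≤ H x) → ν k G ≤ ν k H
  const_mul : ∀ {k : ℕ} (c : ℝ≥0) (G : E k → ℝ≥0∞), ν k (fun x => c * G x) ≤ c * ν k G
  fatou : ∀ {k : ℕ} (G : ℕ → E k → ℝ≥0∞), (∀ j, AEMeasurable (G j) volume) →
    ν k (fun x => liminf (fun j => G j x) atTop) ≤ liminf (fun j => ν k (G j)) atTop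
  comp_smul : ∀ {k : ℕ} (G : E k → ℝ≥0∞) {c : ℝ}, 0 < c →
    ν k (fun x => G (c⁻¹ • x)) ≤ ENNReal.ofReal (c ^ k) ^ (1 / p) * ν k G
  slab : ∀ {k : ℕ} (G : E k → ℝ≥0∞), Measurable G →
    ν k G ≤ ν (k + 1) (fun x => (Set.Icc (0 : ℝ) 1).indicator 1 (x (Fin.last k))
      * G (horizontal x))
  weakNorm_le : ∀ {k : ℕ} (G : E k → ℝ≥0∞), AEMeasurable G volume → weakNorm p G ≤ ν k G

theorem lintegral_comp_inv_smul {k : ℕ} (G : E k → ℝ≥0∞) {c : ℝ} (hc : 0 < c) :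
    ∫⁻ x, G (c⁻¹ • x) = ENNReal.ofReal (c ^ k) * ∫⁻ x, G x := by
  have h := Measure.map_addHaar_smul (volume : Measure (E k)) (inv_ne_zero hc.ne')
  have h2 := lintegral_map_equiv (μ := (volume : Measure (E k))) G
    (Homeomorph.smulOfNeZero c⁻¹ (inv_ne_zero hc.ne')).toMeasurableEquiv
  have h3 : Measure.map ((Homeomorph.smulOfNeZero c⁻¹ (inv_ne_zero hc.ne')).toMeasurableEquiv)
      (volume : Measure (E k)) = Measure.map (c⁻¹ • ·) volume := rfl
  rw [h3, h, lintegral_smul_measure] at h2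
  have h4 : |((c⁻¹) ^ Module.finrank ℝ (E k))⁻¹| = c ^ k := by
    rw [finrank_euclideanSpace_fin, inv_pow, inv_inv, abs_of_pos (by positivity)]
  rw [h4] at h2
  exact h2.symm

theorem volume_preimage_inv_smul {k : ℕ} (s : Set (E k)) {c : ℝ} (hc : 0 < c) :
    volume {x : E k | c⁻¹ • x ∈ s} = ENNReal.ofReal (c ^ k) * volume s := by
  have h := Measure.addHaar_preimage_smul (volume : Measure (E k)) (inv_ne_zero hc.ne') s
  have h4 : |((c⁻¹) ^ Module.finrank ℝ (E k))⁻¹| = c ^ k := by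
    rw [finrank_euclideanSpace_fin, inv_pow, inv_inv, abs_of_pos (by positivity)]
  rw [h4] at h
  exact h

theorem le_weakNorm {k : ℕ} (p : ℝ) (G : E k → ℝ≥0∞) (t : ℝ≥0) :
    (t : ℝ≥0∞) * volume {x | (t : ℝ≥0∞) < G x} ^ (1 / p) ≤ weakNorm p G :=
  le_iSup (fun t : ℝ≥0 => (t : ℝ≥0∞) * volume {x | (t : ℝ≥0∞) < G x} ^ (1 / p)) t

theorem isLebesgueQuasinorm_weakNorm {p : ℝ} (hp : 0 < p) :
    IsLebesgueQuasinorm p (fun k => weakNorm (k := k) p) where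
  mono {k G H} h := by
    refine iSup_le fun t => le_trans ?_ (le_weakNorm p H t)
    refine mul_le_mul_right (ENNReal.rpow_le_rpow (measure_mono_ae ?_) (by positivity)) _
    filter_upwards [h] with x hx hxt using lt_of_lt_of_le hxt hx
  const_mul {k} c G := by
    refine iSup_le fun t => ?_
    rcases eq_or_ne c 0 with rfl | hc
    · simp [hp]
    have hset : {x | (t : ℝ≥0∞) < c * G x} = {x | ((t / c : ℝ≥0) : ℝ≥0∞) < G x} := by
      ext x
      rw [Set.mem_ofPred_eq, Set.mem_ofPred_eq, ENNReal.coe_div hc,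
        ENNReal.div_lt_iff (Or.inl (by simpa using hc)) (Or.inl ENNReal.coe_ne_top), mul_comm]
    rw [hset]
    have ht : (t : ℝ≥0∞) = c * (t / c : ℝ≥0) := by
      rw [← ENNReal.coe_mul, mul_div_cancel₀ _ hc]
    rw [ht, mul_assoc]
    gcongr
    exact le_weakNorm p G _
  fatou {k} G _ := by
    refine iSup_le fun t => ?_
    -- `B J` increases to a set that contains the superlevel set of the lower limit.
    set B : ℕ → Set (E k) := fun J => {x | ∀ j ≥ J, (t : ℝ≥0∞) < G j x} with hB
    have hmono : Monotone B := fun i j hij x hx l hl => hx l (hij.trans hl)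
    have hlim := tendsto_measure_iUnion_atTop (μ := (volume : Measure (E k))) hmono
    have hsub : {x | (t : ℝ≥0∞) < liminf (fun j => G j x) atTop} ⊆ ⋃ J, B J := by
      intro x hx
      have hx' : (t : ℝ≥0∞) < liminf (fun j => G j x) atTop := hx
      obtain ⟨J, hJ⟩ := eventually_atTop.1 (eventually_lt_of_lt_liminf hx')
      exact Set.mem_iUnion.2 ⟨J, hJ⟩
    have hlim2 : Tendsto (fun J => (t : ℝ≥0∞) * volume (B J) ^ (1 / p)) atTop
        (𝓝 (t * volume (⋃ J, B J) ^ (1 / p))) :=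
      ENNReal.Tendsto.const_mul
        ((ENNReal.continuous_rpow_const.tendsto _).comp hlim) (Or.inr ENNReal.coe_ne_top)
    calc (t : ℝ≥0∞) * volume {x | (t : ℝ≥0∞) < liminf (fun j => G j x) atTop} ^ (1 / p)
        ≤ t * volume (⋃ J, B J) ^ (1 / p) := by gcongr
      _ = liminf (fun J => (t : ℝ≥0∞) * volume (B J) ^ (1 / p)) atTop := hlim2.liminf_eq.symm
      _ ≤ _ := by
        refine liminf_le_liminf (Eventually.of_forall fun J => ?_)
        refine le_trans ?_ (le_weakNorm p (G J) t)
        gcongr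
        exact fun x hx => hx J le_rfl
  comp_smul {k} G c hc := by
    refine iSup_le fun t => ?_
    have := volume_preimage_inv_smul {x | (t : ℝ≥0∞) < G x} hc
    simp only [Set.mem_ofPred_eq] at this
    rw [this, ENNReal.mul_rpow_of_nonneg _ _ (by positivity), mul_left_comm]
    gcongr
    exact le_weakNorm p G t
  slab {k} G _ := by
    refine iSup_le fun t => le_trans ?_ (le_weakNorm p _ t)
    have hset : {x : E (k + 1) | (t : ℝ≥0∞) < (Set.Icc (0 : ℝ) 1).indicator 1 (x (Fin.last k))
        * G (horizontal x)} = splitLast k ⁻¹' ({y | (t : ℝ≥0∞) < G y} ×ˢ Set.Icc 0 1) := by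
      ext x
      by_cases hx : x (Fin.last k) ∈ Set.Icc (0 : ℝ) 1
      · simp only [Set.mem_ofPred_eq, Set.mem_preimage, splitLast_apply, Set.mem_prod, hx,
          Set.indicator_of_mem, Pi.one_apply, one_mul, and_true]
      · simp only [Set.mem_ofPred_eq, Set.mem_preimage, splitLast_apply, Set.mem_prod, hx,
          Set.indicator_of_notMem, not_false_eq_true, zero_mul, and_false, not_lt_zero]
    rw [hset, (measurePreserving_splitLast k).measure_preimage_equiv, Measure.volume_eq_prod,
      Measure.prod_prod]
    simp
  weakNorm_le G _ := le_rfl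

theorem eLpNorm_eq_lintegral_rpow {k : ℕ} {p : ℝ} (hp : 0 < p) (G : E k → ℝ≥0∞) :
    eLpNorm G (ENNReal.ofReal p) volume = (∫⁻ x, G x ^ p) ^ (1 / p) := by
  rw [eLpNorm_eq_lintegral_rpow_enorm_toReal (by simpa using hp) ENNReal.ofReal_ne_top,
    ENNReal.toReal_ofReal hp.le]
  simp

theorem isLebesgueQuasinorm_eLpNorm {p : ℝ} (hp : 0 < p) :
    IsLebesgueQuasinorm p (fun k G => eLpNorm (G : E k → ℝ≥0∞) (ENNReal.ofReal p) volume) where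
  mono {k G H} h := by
    simp only [eLpNorm_eq_lintegral_rpow hp]
    gcongr ?_ ^ _
    refine lintegral_mono_ae ?_
    filter_upwards [h] with x hx
    gcongr
  const_mul {k} c G := by
    simp only [eLpNorm_eq_lintegral_rpow hp, ENNReal.mul_rpow_of_nonneg _ _ hp.le]
    rw [lintegral_const_mul' _ _ (by finiteness), ENNReal.mul_rpow_of_nonneg _ _ (by positivity),
      ← ENNReal.rpow_mul, mul_one_div_cancel hp.ne', ENNReal.rpow_one]
  fatou {k} G hG := by
    simp only [eLpNorm_eq_lintegral_rpow hp]
    have hp' : 0 < 1 / p := by positivity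
    have hmap : ∀ (q : ℝ), 0 < q → ∀ u : ℕ → ℝ≥0∞,
        (liminf u atTop) ^ q = liminf (fun j => u j ^ q) atTop := fun q hq u =>
      (ENNReal.monotone_rpow_of_nonneg hq.le).map_liminf_of_continuousAt u
        ENNReal.continuous_rpow_const.continuousAt
    rw [← hmap _ hp' (fun j => ∫⁻ x, G j x ^ p)]
    simp only [hmap p hp]
    gcongr
    exact lintegral_liminf_le' fun j => (hG j).pow_const p
  comp_smul {k} G c hc := by
    simp only [eLpNorm_eq_lintegral_rpow hp]
    rw [lintegral_comp_inv_smul (fun x => G x ^ p) hc,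
      ENNReal.mul_rpow_of_nonneg _ _ (by positivity)]
  slab {k} G hG := by
    simp only [eLpNorm_eq_lintegral_rpow hp]
    gcongr
    have h := (measurePreserving_splitLast k).lintegral_comp_emb
      (splitLast k).measurableEmbedding
      (fun y => (G y.1) ^ p * (Set.Icc (0 : ℝ) 1).indicator 1 y.2)
    rw [Measure.volume_eq_prod, lintegral_prod_mul (hG.pow_const p).aemeasurable
      (measurable_one.indicator measurableSet_Icc).aemeasurable,
      lintegral_indicator_one measurableSet_Icc] at h
    simp only [Real.volume_Icc, sub_zero, ENNReal.ofReal_one, mul_one] at h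
    rw [← h]
    refine lintegral_mono fun x => ?_
    rw [splitLast_apply, ENNReal.mul_rpow_of_nonneg _ _ hp.le, mul_comm]
    gcongr
    by_cases hx : x (Fin.last k) ∈ Set.Icc (0 : ℝ) 1 <;> simp [hx]
  weakNorm_le {k} G hG := by
    refine iSup_le fun t => ?_
    rw [eLpNorm_eq_lintegral_rpow hp]
    have h := mul_meas_ge_le_lintegral₀ (hG.pow_const p) ((t : ℝ≥0∞) ^ p)
    have ht : (t : ℝ≥0∞) = ((t : ℝ≥0∞) ^ p) ^ (1 / p) := by
      rw [← ENNReal.rpow_mul, mul_one_div_cancel hp.ne', ENNReal.rpow_one]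
    nth_rewrite 1 [ht]
    rw [← ENNReal.mul_rpow_of_nonneg _ _ (by positivity)]
    gcongr ?_ ^ _
    refine le_trans ?_ h
    gcongr
    intro hx
    exact ENNReal.rpow_le_rpow hx.le hp.le

/-! ### Multipliers and constant families -/

theorem contDiffOn_of_mihlinNorm_lt_top {d A : ℕ} {m : E d → ℂ} (hm : mihlinNorm A m < ⊤) :
    ContDiffOn ℝ A m {0}ᶜ := by
  by_contra h
  simp [mihlinNorm, h] at hm

theorem enorm_le_mihlinNorm {d A : ℕ} (m : E d → ℂ) {η : E d} (hη : η ≠ 0) :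
    ‖m η‖ₑ ≤ mihlinNorm A m := by
  unfold mihlinNorm
  split_ifs with h
  · refine le_iSup₂_of_le 0 (Nat.zero_le _) (le_iSup_of_le Fin.elim0 (le_iSup₂_of_le η hη ?_))
    simp
  · exact le_top

theorem iteratedFDeriv_comp_smul {d : ℕ} (m : E d → ℂ) {c : ℝ} (hc : c ≠ 0) (k : ℕ) (η : E d)
    (v : Fin k → E d) :
    iteratedFDeriv ℝ k (fun y => m (c • y)) η v = c ^ k • iteratedFDeriv ℝ k m (c • η) v := by
  have h := (ContinuousLinearEquiv.smulLeft (R₁ := ℝ) (M₁ := E d)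
    (Units.mk0 c hc)).iteratedFDerivWithin_comp_right m uniqueDiffOn_univ (x := η)
      (Set.mem_univ _) k
  simp only [Set.preimage_univ, iteratedFDerivWithin_univ] at h
  have h2 : iteratedFDeriv ℝ k (fun y => m (c • y)) η v = iteratedFDeriv ℝ k m (c • η)
      (fun i => c • v i) := congrArg (fun T => T v) h
  rw [h2, ContinuousMultilinearMap.map_smul_univ]
  simp

/-- The Hörmander--Mihlin norm is invariant under dilations and homogeneous. -/
theorem mihlinNorm_mul_comp_smul_le {d A : ℕ} {m : E d → ℂ} (hm : ContDiffOn ℝ A m {0}ᶜ)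
    (K : ℝ) {c : ℝ} (hc : 0 < c) :
    mihlinNorm A (fun η => (K : ℂ) * m (c • η)) ≤ ‖K‖ₑ * mihlinNorm A m := by
  have hmaps : Set.MapsTo (fun η : E d => c • η) {0}ᶜ {0}ᶜ := by
    intro η hη
    simpa [hc.ne'] using hη
  have hcomp : ContDiffOn ℝ A (fun η => m (c • η)) {0}ᶜ :=
    hm.comp (contDiff_const_smul c).contDiffOn hmaps
  have hKm : ContDiffOn ℝ A (fun η => (K : ℂ) * m (c • η)) {0}ᶜ := contDiffOn_const.mul hcomp
  have hopen : IsOpen ({0}ᶜ : Set (E d)) := isOpen_compl_singleton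
  simp only [mihlinNorm, if_pos hm, if_pos hKm]
  refine iSup₂_le fun k hk => iSup_le fun i => iSup₂_le fun η hη => ?_
  have hsm : iteratedFDeriv ℝ k (fun η => (K : ℂ) * m (c • η)) η
      = K • iteratedFDeriv ℝ k (fun η => m (c • η)) η := by
    have := iteratedFDeriv_const_smul_apply' (a := K)
      (((hcomp.contDiffAt (hopen.mem_nhds hη)).of_le
        (by exact_mod_cast hk : (k : WithTop ℕ∞) ≤ A)))
    simpa using this
  rw [hsm, smul_apply, iteratedFDeriv_comp_smul m hc.ne', enorm_smul,
    enorm_smul, mul_left_comm]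
  gcongr
  refine le_trans (le_of_eq ?_) (le_iSup₂_of_le k hk (le_iSup_of_le i
    (le_iSup₂_of_le (c • η) (hmaps hη) le_rfl)))
  rw [enorm_smul, mul_pow, enorm_pow, ← mul_assoc, mul_comm (‖η‖ₑ ^ k)]

theorem mihlinNorm_zero {d : ℕ} (A : ℕ) : mihlinNorm A (fun _ : E d => (0 : ℂ)) = 0 := by
  rw [mihlinNorm, if_pos contDiffOn_const]
  have : (fun _ : E d => (0 : ℂ)) = 0 := rfl
  simp [this]

/-- For a constant family the term with the logarithm vanishes, also where `σ = τ`. -/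
theorem familyNorm_const {d : ℕ} (A : ℕ) (m : E d → ℂ) :
    familyNorm A (fun _ => m) ≤ mihlinNorm A m := by
  refine iSup₂_le fun σ τ => ?_
  simp [mihlinNorm_zero]

theorem measurable_of_contDiffOn {d A : ℕ} {m : E d → ℂ} (hm : ContDiffOn ℝ A m {0}ᶜ) :
    Measurable m :=
  measurable_of_continuousOn_compl_singleton 0 hm.continuousOn

/-- A Mihlin multiplier is bounded everywhere, with a bound that also covers its value at `0`. -/
theorem exists_norm_le_of_mihlinNorm_lt_top {d A : ℕ} {m : E d → ℂ}
    (hm : mihlinNorm A m < ⊤) : ∃ B : ℝ, 0 ≤ B ∧ ∀ η, ‖m η‖ ≤ B := by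
  refine ⟨max (mihlinNorm A m).toReal ‖m 0‖, by positivity, fun η => ?_⟩
  by_cases hη : η = 0
  · rw [hη]; exact le_max_right _ _
  · refine le_max_of_le_left ?_
    have := ENNReal.toReal_mono hm.ne (enorm_le_mihlinNorm (A := A) m hη)
    simpa using this

/-! ### Rotations close to the identity -/

/-- The projection `ℝ^{d+1} → ℝᵈ` onto the first `d` coordinates as a continuous linear map. -/
noncomputable def horizontalL (d : ℕ) : E (d + 1) →L[ℝ] E d :=
  LinearMap.toContinuousLinearMap
    { toFun := horizontal
      map_add' := fun x y => by ext i; simp [horizontal]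
      map_smul' := fun c x => by ext i; simp [horizontal] }

theorem horizontalL_apply {d : ℕ} (x : E (d + 1)) : horizontalL d x = horizontal x := rfl

theorem horizontal_eLast (d : ℕ) : horizontal (eLast d) = 0 := by
  ext i
  simp [horizontal, eLast]

theorem norm_eLast (d : ℕ) : ‖eLast d‖ = 1 := by simp [eLast]

theorem inner_eLast {d : ℕ} (x : E (d + 1)) : (inner ℝ (eLast d) x : ℝ) = x (Fin.last d) := by
  simp [eLast, EuclideanSpace.inner_single_left]

/-- The rotation `V` maps the normal of `σ` to `e_{d+1}`, so that projecting to `σ` before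
rotating is invisible in the first `d` coordinates. -/
theorem horizontal_rotation_projOnto {d : ℕ} {σ : Gr d} {V : E (d + 1) ≃ₗᵢ[ℝ] E (d + 1)}
    (hV : V ∈ rotationsTo σ) (ξ : E (d + 1)) :
    horizontal (V (projOnto σ ξ)) = horizontal (V ξ) := by
  have h : projOnto σ ξ = ξ - (ℝ ∙ (σ : E (d + 1))).starProjection ξ := by
    rw [projOnto, Submodule.starProjection_orthogonal_val]
  rw [h, Submodule.starProjection_singleton, map_sub, map_smul, hV.2, ← horizontalL_apply,
    map_sub, map_smul, horizontalL_apply, horizontalL_apply, horizontal_eLast, smul_zero, sub_zero]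

/-- The product of the half-turns about the lines spanned by `e_{d+1}` and by `(w, 1)` is a rotation
that tilts `e_{d+1}` in the direction of `w`. -/
theorem exists_rotation {d : ℕ} (w : E d) : ∃ (σ : Gr d) (V : E (d + 1) ≃ₗᵢ[ℝ] E (d + 1)),
    V ∈ rotationsTo σ ∧ ∀ ξ, horizontal (V ξ) = horizontal ξ
      + (2 * (ξ (Fin.last d) - inner ℝ w (horizontal ξ)) / (1 + ‖w‖ ^ 2)) • w := by
  set u : E (d + 1) := (splitLast d).symm (w, 1) with hu
  have hsplit : (horizontal u, u (Fin.last d)) = (w, (1 : ℝ)) := by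
    rw [← splitLast_apply, hu, MeasurableEquiv.apply_symm_apply]
  have huw : horizontal u = w := congrArg Prod.fst hsplit
  have hu1 : u (Fin.last d) = 1 := congrArg Prod.snd hsplit
  have hinner : ∀ y : E (d + 1), (inner ℝ u y : ℝ)
      = inner ℝ w (horizontal y) + y (Fin.last d) := fun y => by
    rw [inner_eq_horizontal_add, huw, hu1, one_mul]
  have hnorm : ‖u‖ ^ 2 = 1 + ‖w‖ ^ 2 := by
    rw [← real_inner_self_eq_norm_sq, hinner, huw, hu1, real_inner_self_eq_norm_sq, add_comm]
  have hu0 : u ≠ 0 := by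
    intro h
    rw [h] at hu1
    simp at hu1
  have he0 : eLast d ≠ 0 := by
    rw [← norm_ne_zero_iff, norm_eLast]
    exact one_ne_zero
  set V : E (d + 1) ≃ₗᵢ[ℝ] E (d + 1) :=
    (ℝ ∙ eLast d).reflection.trans (ℝ ∙ u).reflection with hV
  have hσ : ‖V.symm (eLast d)‖ = 1 := by rw [LinearIsometryEquiv.norm_map, norm_eLast]
  refine ⟨⟨V.symm (eLast d), by simpa using hσ⟩, V, ⟨?_, by simp⟩, fun ξ => ?_⟩
  · have : Fact (Module.finrank ℝ (E (d + 1)) = d + 1) := ⟨by simp⟩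
    have hcomp : (V.toLinearEquiv : E (d + 1) →ₗ[ℝ] E (d + 1))
        = ((ℝ ∙ u).reflection.toLinearEquiv : E (d + 1) →ₗ[ℝ] E (d + 1)) ∘ₗ
          ((ℝ ∙ eLast d).reflection.toLinearEquiv : E (d + 1) →ₗ[ℝ] E (d + 1)) := rfl
    rw [hcomp, LinearMap.det_comp, Submodule.det_reflection, Submodule.det_reflection,
      Submodule.finrank_orthogonal_span_singleton (n := d) hu0,
      Submodule.finrank_orthogonal_span_singleton (n := d) he0, ← mul_pow]
    simp
  · have hy : (ℝ ∙ eLast d).reflection ξ = (2 * ξ (Fin.last d)) • eLast d - ξ := by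
      rw [Submodule.reflection_singleton_apply, inner_eLast, norm_eLast]
      simp [two_smul, two_mul, add_smul]
    have hyh : horizontal ((ℝ ∙ eLast d).reflection ξ) = - horizontal ξ := by
      rw [hy, ← horizontalL_apply, map_sub, map_smul, horizontalL_apply, horizontal_eLast]
      simp [horizontalL_apply]
    have hyl : ((ℝ ∙ eLast d).reflection ξ) (Fin.last d) = ξ (Fin.last d) := by
      rw [hy]
      simp [eLast]
      ring
    have hVξ : V ξ = (ℝ ∙ u).reflection ((ℝ ∙ eLast d).reflection ξ) := rfl
    rw [hVξ, Submodule.reflection_singleton_apply, hinner, hyh, hyl, ← horizontalL_apply, map_sub,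
      horizontalL_apply, horizontalL_apply, hyh, two_smul, ← add_smul, ← horizontalL_apply,
      map_smul, horizontalL_apply, huw, sub_neg_eq_add, add_comm (horizontal ξ)]
    congr 2
    rw [inner_neg_right]
    have : ((‖u‖ : ℝ) : ℝ) ^ 2 = 1 + ‖w‖ ^ 2 := hnorm
    simp only [RCLike.ofReal_real_eq_id, id_eq, this]
    ring

/-! ### Tensor products of Schwartz functions -/

theorem exists_one_add_pow_mul_norm_iteratedFDeriv_comp_le {D D' : Type*} [NormedAddCommGroup D]
    [NormedSpace ℝ D] [NormedAddCommGroup D'] [NormedSpace ℝ D'] (L : D →L[ℝ] D')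
    (φ : 𝓢(D', ℂ)) (k i : ℕ) : ∃ C : ℝ, 0 ≤ C ∧ ∀ x,
      (1 + ‖L x‖) ^ k * ‖iteratedFDeriv ℝ i (fun y => φ (L y)) x‖ ≤ C := by
  refine ⟨2 ^ k * ((Finset.Iic (k, i)).sup fun m => SchwartzMap.seminorm ℝ m.1 m.2) φ * ‖L‖ ^ i,
    by positivity, fun x => ?_⟩
  have h1 := SchwartzMap.one_add_le_sup_seminorm_apply (𝕜 := ℝ) (m := (k, i)) le_rfl le_rfl φ
    (L x)
  have h2 := L.iteratedFDeriv_comp_right (φ.smooth ⊤) x (i := i) (by exact_mod_cast le_top)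
  have h3 : ‖iteratedFDeriv ℝ i (fun y => φ (L y)) x‖
      ≤ ‖iteratedFDeriv ℝ i φ (L x)‖ * ‖L‖ ^ i := by
    refine (congrArg norm h2).le.trans ?_
    refine (ContinuousMultilinearMap.norm_compContinuousLinearMap_le _ _).trans ?_
    simp
  calc (1 + ‖L x‖) ^ k * ‖iteratedFDeriv ℝ i (fun y => φ (L y)) x‖
      ≤ (1 + ‖L x‖) ^ k * (‖iteratedFDeriv ℝ i φ (L x)‖ * ‖L‖ ^ i) := by gcongr
    _ = ((1 + ‖L x‖) ^ k * ‖iteratedFDeriv ℝ i φ (L x)‖) * ‖L‖ ^ i := by ring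
    _ ≤ _ := by gcongr

/-- The function `f (L₁ x) g (L₂ x)` is a Schwartz function if `f` and `g` are, and if `x` is
controlled by `L₁ x` and `L₂ x`. -/
noncomputable def schwartzTensor {D D₁ D₂ : Type*} [NormedAddCommGroup D] [NormedSpace ℝ D]
    [NormedAddCommGroup D₁] [NormedSpace ℝ D₁] [NormedAddCommGroup D₂] [NormedSpace ℝ D₂]
    (L₁ : D →L[ℝ] D₁) (L₂ : D →L[ℝ] D₂) (hL : ∀ x, ‖x‖ ≤ ‖L₁ x‖ + ‖L₂ x‖)
    (f : 𝓢(D₁, ℂ)) (g : 𝓢(D₂, ℂ)) : 𝓢(D, ℂ) where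
  toFun x := f (L₁ x) * g (L₂ x)
  smooth' := ((f.smooth ⊤).comp L₁.contDiff).mul ((g.smooth ⊤).comp L₂.contDiff)
  decay' k n := by
    choose C₁ hC₁ hf using exists_one_add_pow_mul_norm_iteratedFDeriv_comp_le L₁ f k
    choose C₂ hC₂ hg using exists_one_add_pow_mul_norm_iteratedFDeriv_comp_le L₂ g k
    refine ⟨∑ i ∈ Finset.range (n + 1), (n.choose i : ℝ) * C₁ i * C₂ (n - i), fun x => ?_⟩
    have hx : ‖x‖ ^ k ≤ (1 + ‖L₁ x‖) ^ k * (1 + ‖L₂ x‖) ^ k := by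
      rw [← mul_pow]
      gcongr
      nlinarith [hL x, norm_nonneg (L₁ x), norm_nonneg (L₂ x),
        mul_nonneg (norm_nonneg (L₁ x)) (norm_nonneg (L₂ x))]
    have hmul := norm_iteratedFDeriv_mul_le (𝕜 := ℝ) ((f.smooth ⊤).comp L₁.contDiff)
      ((g.smooth ⊤).comp L₂.contDiff) x (n := n) (by exact_mod_cast le_top)
    calc ‖x‖ ^ k * ‖iteratedFDeriv ℝ n (fun x => f (L₁ x) * g (L₂ x)) x‖
        ≤ ((1 + ‖L₁ x‖) ^ k * (1 + ‖L₂ x‖) ^ k) * ∑ i ∈ Finset.range (n + 1), (n.choose i : ℝ)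
          * ‖iteratedFDeriv ℝ i (fun y => f (L₁ y)) x‖
          * ‖iteratedFDeriv ℝ (n - i) (fun y => g (L₂ y)) x‖ := by
            gcongr
            exact hmul
      _ = ∑ i ∈ Finset.range (n + 1), (n.choose i : ℝ)
          * ((1 + ‖L₁ x‖) ^ k * ‖iteratedFDeriv ℝ i (fun y => f (L₁ y)) x‖)
          * ((1 + ‖L₂ x‖) ^ k * ‖iteratedFDeriv ℝ (n - i) (fun y => g (L₂ y)) x‖) := by
            rw [Finset.mul_sum]
            exact Finset.sum_congr rfl fun i _ => by ring
      _ ≤ _ := by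
            refine Finset.sum_le_sum fun i _ => ?_
            have := hf i x
            have := hg (n - i) x
            have := hC₁ i
            gcongr

/-- The tensor product `x ↦ f(x_1, …, x_d) g(x_{d+1})`. -/
noncomputable def tensorLast {d : ℕ} (f : 𝓢(E d, ℂ)) (g : 𝓢(ℝ, ℂ)) : 𝓢(E (d + 1), ℂ) :=
  schwartzTensor (horizontalL d) (EuclideanSpace.proj (Fin.last d)) (fun x => by
    have h : ‖x‖ ^ 2 = ‖horizontal x‖ ^ 2 + x (Fin.last d) * x (Fin.last d) := by
      rw [← real_inner_self_eq_norm_sq, inner_eq_horizontal_add, real_inner_self_eq_norm_sq]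
    have h2 : |x (Fin.last d)| * |x (Fin.last d)| = x (Fin.last d) * x (Fin.last d) :=
      abs_mul_abs_self _
    have h3 : ‖(EuclideanSpace.proj (Fin.last d) : E (d + 1) →L[ℝ] ℝ) x‖ = |x (Fin.last d)| := rfl
    rw [h3, horizontalL_apply]
    refine abs_le_of_sq_le_sq' ?_ (by positivity) |>.2
    nlinarith [norm_nonneg (horizontal x), abs_nonneg (x (Fin.last d)),
      mul_nonneg (norm_nonneg (horizontal x)) (abs_nonneg (x (Fin.last d)))]) f g

theorem tensorLast_apply {d : ℕ} (f : 𝓢(E d, ℂ)) (g : 𝓢(ℝ, ℂ)) (x : E (d + 1)) :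
    tensorLast f g x = f (horizontal x) * g (x (Fin.last d)) := rfl

/-! ### Fourier integrals -/

theorem char_comm {k : ℕ} (x ξ : E k) : char x ξ = char ξ x := by
  simp [char, real_inner_comm]

theorem norm_char {k : ℕ} (x ξ : E k) : ‖char x ξ‖ = 1 := by
  have : 2 * (Real.pi : ℂ) * Complex.I * ((inner ℝ x ξ : ℝ) : ℂ)
      = ((2 * Real.pi * inner ℝ x ξ : ℝ) : ℂ) * Complex.I := by push_cast; ring
  rw [char, this, Complex.norm_exp_ofReal_mul_I]

theorem continuous_char {k : ℕ} : Continuous fun q : E k × E k => char q.1 q.2 := by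
  unfold char
  fun_prop

theorem char_add_right {k : ℕ} (x ξ η : E k) : char x (ξ + η) = char x ξ * char x η := by
  rw [char, char, char, ← Complex.exp_add, inner_add_right]
  push_cast
  ring_nf

theorem char_smul_smul {k : ℕ} {c : ℝ} (hc : c ≠ 0) (x ξ : E k) :
    char (c⁻¹ • x) (c • ξ) = char x ξ := by
  rw [char, inner_smul_left, inner_smul_right]
  simp [hc, char]

theorem fourierInv_eq_integral_char {k : ℕ} (f : E k → ℂ) (x : E k) :
    𝓕⁻ f x = ∫ ξ, f ξ * char x ξ := by
  rw [Real.fourierInv_eq']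
  refine integral_congr_ae (Eventually.of_forall fun ξ => ?_)
  simp only [smul_eq_mul, char, real_inner_comm x ξ]
  rw [mul_comm]
  congr 2
  push_cast
  ring

theorem fourierInv_real_eq_integral (f : ℝ → ℂ) (s : ℝ) :
    𝓕⁻ f s = ∫ t, f t * Complex.exp (2 * (Real.pi : ℂ) * Complex.I * ((s * t : ℝ) : ℂ)) := by
  rw [Real.fourierInv_eq']
  refine integral_congr_ae (Eventually.of_forall fun ξ => ?_)
  simp only [smul_eq_mul, RCLike.inner_apply, conj_trivial]
  rw [mul_comm]
  congr 2
  push_cast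
  ring

/-- The Fourier integral of a function that splits off the last coordinate. -/
theorem integral_tensor_mul_char {d : ℕ} (k : E d → ℂ) (g : 𝓢(ℝ, ℂ)) (x : E (d + 1)) :
    ∫ ξ : E (d + 1), k (horizontal ξ) * 𝓕 g (ξ (Fin.last d)) * char x ξ
      = (∫ η, k η * char (horizontal x) η) * g (x (Fin.last d)) := by
  have h := (measurePreserving_splitLast d).integral_comp (splitLast d).measurableEmbedding
    (fun y => (k y.1 * char (horizontal x) y.1) * (𝓕 g y.2
      * Complex.exp (2 * (Real.pi : ℂ) * Complex.I * ((x (Fin.last d) * y.2 : ℝ) : ℂ))))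
  rw [Measure.volume_eq_prod, integral_prod_mul (fun η => k η * char (horizontal x) η)
    (fun s => 𝓕 g s * Complex.exp (2 * (Real.pi : ℂ) * Complex.I * ((x (Fin.last d) * s : ℝ) : ℂ))),
    ← fourierInv_real_eq_integral, ← SchwartzMap.fourierInv_coe,
    FourierTransform.fourierInv_fourier_eq] at h
  rw [← h]
  refine integral_congr_ae (Eventually.of_forall fun ξ => ?_)
  simp only [splitLast_apply]
  have : char x ξ = char (horizontal x) (horizontal ξ)
      * Complex.exp (2 * (Real.pi : ℂ) * Complex.I
        * ((x (Fin.last d) * ξ (Fin.last d) : ℝ) : ℂ)) := by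
    rw [char, char, ← Complex.exp_add, inner_eq_horizontal_add]
    push_cast
    ring_nf
  rw [this]
  ring

/-- The inverse Fourier transform of `f̂ ⊗ ĝ` is `f ⊗ g`. -/
theorem fourierInv_tensorLast_fourier {d : ℕ} (f : 𝓢(E d, ℂ)) (g : 𝓢(ℝ, ℂ)) :
    𝓕⁻ (tensorLast (𝓕 f) (𝓕 g)) = tensorLast f g := by
  ext x
  rw [SchwartzMap.fourierInv_coe, fourierInv_eq_integral_char, tensorLast_apply]
  simp only [tensorLast_apply]
  rw [integral_tensor_mul_char, ← fourierInv_eq_integral_char, ← SchwartzMap.fourierInv_coe,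
    FourierTransform.fourierInv_fourier_eq]

theorem eLpNorm_tensorLast {d : ℕ} {p : ℝ} (hp : 0 < p) (f : 𝓢(E d, ℂ)) (g : 𝓢(ℝ, ℂ)) :
    eLpNorm (tensorLast f g) (ENNReal.ofReal p) volume
      = eLpNorm f (ENNReal.ofReal p) volume * eLpNorm g (ENNReal.ofReal p) volume := by
  have hp0 : ENNReal.ofReal p ≠ 0 := by simpa using hp
  have h := (measurePreserving_splitLast d).lintegral_comp_emb
    (splitLast d).measurableEmbedding
    (fun y => ‖f y.1‖ₑ ^ p * ‖g y.2‖ₑ ^ p)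
  rw [Measure.volume_eq_prod, lintegral_prod_mul
    (f.continuous.enorm.measurable.pow_const p).aemeasurable
    (g.continuous.enorm.measurable.pow_const p).aemeasurable] at h
  simp only [splitLast_apply] at h
  simp only [eLpNorm_eq_lintegral_rpow_enorm_toReal hp0 ENNReal.ofReal_ne_top,
    ENNReal.toReal_ofReal hp.le, tensorLast_apply, enorm_mul, ENNReal.mul_rpow_of_nonneg _ _ hp.le]
  rw [h, ENNReal.mul_rpow_of_nonneg _ _ (by positivity)]

/-! ### The maximal operators are measurable -/

theorem continuous_integral_mul_char {k : ℕ} {q : E k → ℂ} (hq : Integrable q volume) :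
    Continuous fun x => ∫ ξ, q ξ * char x ξ := by
  have hchar : ∀ x : E k, Continuous fun ξ => char x ξ := fun x =>
    continuous_char.comp (by fun_prop : Continuous fun ξ : E k => (x, ξ))
  refine continuous_of_dominated (bound := fun ξ => ‖q ξ‖)
    (fun x => hq.aestronglyMeasurable.mul (hchar x).aestronglyMeasurable)
    (fun x => Eventually.of_forall fun ξ => ?_) hq.norm (Eventually.of_forall fun ξ => ?_)
  · rw [norm_mul, norm_char, mul_one]
  · exact continuous_const.mul
      (continuous_char.comp (by fun_prop : Continuous fun x : E k => (x, ξ)))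

theorem integrable_mul_of_norm_le {k : ℕ} {b q : E k → ℂ} {B : ℝ} (hb : Measurable b)
    (hB : ∀ ξ, ‖b ξ‖ ≤ B) (hq : Integrable q volume) : Integrable (fun ξ => b ξ * q ξ) volume :=
  hq.bdd_mul hb.aestronglyMeasurable (Eventually.of_forall hB)

theorem measurable_maximalOp {d : ℕ} {m : Gr d → E d → ℂ} (hm : ∀ σ, Measurable (m σ))
    {B : ℝ} (hB : ∀ σ η, ‖m σ η‖ ≤ B) {f : E (d + 1) → ℂ} (hf : Integrable (𝓕 f) volume) :
    Measurable (maximalOp m f) := by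
  refine LowerSemicontinuous.measurable (lowerSemicontinuous_iSup fun σ =>
    lowerSemicontinuous_biSup fun V _ => Continuous.lowerSemicontinuous ?_)
  refine Continuous.enorm (continuous_integral_mul_char
    (integrable_mul_of_norm_le (B := B) ?_ (fun ξ => hB _ _) hf))
  refine (hm σ).comp ((horizontalL d).continuous.measurable.comp (V.continuous.measurable.comp ?_))
  exact ((ℝ ∙ (σ : E (d + 1)))ᗮ.starProjection).continuous.measurable

theorem carlesonSjolin_eq {d : ℕ} (m f : E d → ℂ) (x : E d) :
    carlesonSjolin m f x = ⨆ N : E d, ‖∫ η, (m (η + N) * 𝓕 f η) * char x η‖ₑ := by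
  refine iSup_congr fun N => ?_
  simp only [char_comm x, mul_comm (m _)]

theorem measurable_carlesonSjolin {d : ℕ} {m : E d → ℂ} (hm : Measurable m) {B : ℝ}
    (hB : ∀ η, ‖m η‖ ≤ B) (f : 𝓢(E d, ℂ)) : Measurable (carlesonSjolin m f) := by
  have h : carlesonSjolin m f = fun x => ⨆ N : E d, ‖∫ η, (m (η + N) * 𝓕 f η) * char x η‖ₑ := by
    ext x
    exact carlesonSjolin_eq m f x
  rw [h]
  refine LowerSemicontinuous.measurable (lowerSemicontinuous_iSup fun N =>
    Continuous.lowerSemicontinuous (Continuous.enorm (continuous_integral_mul_char ?_)))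
  exact integrable_mul_of_norm_le (hm.comp (measurable_add_const N)) (fun η => hB _)
    (𝓕 f).integrable

/-! ### Wave packets in `ℝ^{d+1}` -/

theorem IsAnnularBump.hasCompactSupport {k : ℕ} {ζ : E k → ℝ} (hζ : IsAnnularBump ζ) :
    HasCompactSupport ζ := by
  refine HasCompactSupport.of_support_subset_isCompact (isCompact_closedBall 0 (3 / 2)) ?_
  intro ξ hξ
  have := hζ.supp (subset_tsupport _ hξ)
  simpa using this.2.le

/-- The Fourier transform of `P_0 F` is `ζ F̂`, a Schwartz function. -/
theorem exists_fourier_annularProj {k : ℕ} {ζ : E k → ℝ} (hζ : IsAnnularBump ζ)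
    (F : 𝓢(E k, ℂ)) : ∃ q : 𝓢(E k, ℂ), 𝓕 (annularProj ζ F) = q ∧
      ∀ ξ, q ξ = (ζ ξ : ℂ) * 𝓕 F ξ := by
  have hc : HasCompactSupport (fun ξ => (ζ ξ : ℂ)) :=
    hζ.hasCompactSupport.comp_left (g := ((↑) : ℝ → ℂ)) Complex.ofReal_zero
  have hs : ContDiff ℝ ∞ (fun ξ => (ζ ξ : ℂ)) := Complex.ofRealCLM.contDiff.comp hζ.smooth
  have ht : Function.HasTemperateGrowth (fun ξ => (ζ ξ : ℂ)) :=
    (hc.toSchwartzMap hs).hasTemperateGrowth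
  set q : 𝓢(E k, ℂ) := SchwartzMap.smulLeftCLM ℂ (fun ξ => (ζ ξ : ℂ)) (𝓕 F) with hq
  have hqa : ∀ ξ, q ξ = (ζ ξ : ℂ) * 𝓕 F ξ := fun ξ => by
    rw [hq, SchwartzMap.smulLeftCLM_apply_apply ht, smul_eq_mul]
  refine ⟨q, ?_, hqa⟩
  have h : annularProj ζ F = 𝓕⁻ q := by
    ext x
    rw [SchwartzMap.fourierInv_coe, fourierInv_eq_integral_char]
    simp only [hqa]
    rfl
  rw [h, ← SchwartzMap.fourier_coe, FourierTransform.fourier_fourierInv_eq]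

/-- The substitution `ξ = v + c η`. -/
theorem integral_eq_integral_add_smul {k : ℕ} (Φ : E k → ℂ) (v : E k) {c : ℝ} (hc : 0 < c) :
    ∫ ξ, Φ ξ = ((c ^ k : ℝ) : ℂ) * ∫ η, Φ (v + c • η) := by
  have h := Measure.integral_comp_smul (volume : Measure (E k)) (fun η => Φ (v + η)) c
  rw [integral_add_left_eq_self, finrank_euclideanSpace_fin, abs_of_pos (by positivity)] at h
  rw [h, Complex.real_smul, ← mul_assoc, ← Complex.ofReal_mul, mul_inv_cancel₀ (by positivity)]
  simp

/-- The function on `ℝ^{d+1}` whose Fourier transform is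
`ε^{-(d+1)} (φ̂ ⊗ ĝ)((ξ - r e_{d+1}) / ε)`, that is, the modulation of `(φ ⊗ g)(ε x)` to
the frequency `r e_{d+1}`. The value at `ε = 0` is a dummy. -/
noncomputable def wavePacket {d : ℕ} (φ : 𝓢(E d, ℂ)) (g : 𝓢(ℝ, ℂ)) (r ε : ℝ) :
    𝓢(E (d + 1), ℂ) :=
  if hε : ε = 0 then 0 else
  𝓕⁻ ((((ε ^ (d + 1))⁻¹ : ℝ) : ℂ) • SchwartzMap.compSubConstCLM ℂ (r • eLast d)
    (SchwartzMap.compCLMOfContinuousLinearEquiv ℂ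
      (ContinuousLinearEquiv.smulLeft (R₁ := ℝ) (M₁ := E (d + 1)) (Units.mk0 ε hε)⁻¹)
      (tensorLast (𝓕 φ) (𝓕 g))))

theorem fourier_wavePacket {d : ℕ} (φ : 𝓢(E d, ℂ)) (g : 𝓢(ℝ, ℂ)) (r : ℝ) {ε : ℝ} (hε : 0 < ε)
    (ξ : E (d + 1)) : 𝓕 (wavePacket φ g r ε) ξ = (((ε ^ (d + 1))⁻¹ : ℝ) : ℂ)
      * tensorLast (𝓕 φ) (𝓕 g) (ε⁻¹ • (ξ - r • eLast d)) := by
  rw [wavePacket, dif_neg hε.ne', FourierTransform.fourier_fourierInv_eq]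
  rfl

theorem fourier_wavePacket_add_smul {d : ℕ} (φ : 𝓢(E d, ℂ)) (g : 𝓢(ℝ, ℂ)) (r : ℝ) {ε : ℝ}
    (hε : 0 < ε) (η : E (d + 1)) : 𝓕 (wavePacket φ g r ε) (r • eLast d + ε • η)
      = (((ε ^ (d + 1))⁻¹ : ℝ) : ℂ) * tensorLast (𝓕 φ) (𝓕 g) η := by
  rw [fourier_wavePacket φ g r hε, add_sub_cancel_left, inv_smul_smul₀ hε.ne']

theorem norm_wavePacket {d : ℕ} (φ : 𝓢(E d, ℂ)) (g : 𝓢(ℝ, ℂ)) (r : ℝ) {ε : ℝ} (hε : 0 < ε)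
    (x : E (d + 1)) : ‖wavePacket φ g r ε x‖ₑ = ‖tensorLast φ g (ε • x)‖ₑ := by
  have h0 : wavePacket φ g r ε x = ∫ ξ, 𝓕 (wavePacket φ g r ε) ξ * char x ξ := by
    rw [← fourierInv_eq_integral_char, ← SchwartzMap.fourierInv_coe,
      FourierTransform.fourierInv_fourier_eq]
  have h1 : tensorLast φ g (ε • x)
      = ∫ ξ, tensorLast (𝓕 φ) (𝓕 g) ξ * char (ε • x) ξ := by
    rw [← fourierInv_eq_integral_char, ← SchwartzMap.fourierInv_coe,
      fourierInv_tensorLast_fourier]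
  have h2 : ∀ η, 𝓕 (wavePacket φ g r ε) (r • eLast d + ε • η) * char x (r • eLast d + ε • η)
      = ((((ε ^ (d + 1))⁻¹ : ℝ) : ℂ) * char x (r • eLast d))
        * (tensorLast (𝓕 φ) (𝓕 g) η * char (ε • x) η) := fun η => by
    have h3 : char x (ε • η) = char (ε • x) η := by
      rw [← char_smul_smul hε.ne' (ε • x) η, inv_smul_smul₀ hε.ne']
    rw [fourier_wavePacket_add_smul φ g r hε, char_add_right, h3]
    ring
  rw [h0, integral_eq_integral_add_smul _ (r • eLast d) hε]
  simp only [h2]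
  rw [integral_const_mul, ← h1, ← mul_assoc, ← mul_assoc, ← Complex.ofReal_mul,
    mul_inv_cancel₀ (by positivity), enorm_mul, enorm_mul, ← ofReal_norm (char _ _),
    norm_char]
  simp

/-- The dilation factor is the one of `IsLebesgueQuasinorm.comp_smul`, so that the bounds for the
maximal operator do not depend on `ε` after rescaling. -/
theorem eLpNorm_wavePacket_le {d : ℕ} {p : ℝ} (hp : 0 < p) (φ : 𝓢(E d, ℂ)) (g : 𝓢(ℝ, ℂ))
    (r : ℝ) {ε : ℝ} (hε : 0 < ε) :
    ENNReal.ofReal (ε ^ (d + 1)) ^ (1 / p)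
        * eLpNorm (wavePacket φ g r ε) (ENNReal.ofReal p) volume
      ≤ eLpNorm φ (ENNReal.ofReal p) volume * eLpNorm g (ENNReal.ofReal p) volume := by
  have h1 : eLpNorm (wavePacket φ g r ε) (ENNReal.ofReal p) volume
      = eLpNorm (fun x => ‖tensorLast φ g ((ε⁻¹)⁻¹ • x)‖ₑ) (ENNReal.ofReal p) volume := by
    refine eLpNorm_congr_enorm_ae (Eventually.of_forall fun x => ?_)
    rw [norm_wavePacket φ g r hε, inv_inv, enorm_eq_self]
  have h2 := (isLebesgueQuasinorm_eLpNorm hp).comp_smul (fun x => ‖tensorLast φ g x‖ₑ)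
    (inv_pos.2 hε)
  rw [← eLpNorm_tensorLast hp, h1]
  refine (mul_le_mul_right h2 _).trans (le_of_eq ?_)
  rw [← mul_assoc, ← ENNReal.mul_rpow_of_nonneg _ _ (by positivity),
    ← ENNReal.ofReal_mul (by positivity), ← mul_pow, mul_inv_cancel₀ hε.ne']
  simp

/-! ### Transference -/

/-- The factor of `N` in `V(r e_{d+1} + ε η)` after rescaling, where `V` tilts `e_{d+1}` in the
direction of `N` by an angle of order `ε`. It tends to `1` as `ε → 0`. -/
noncomputable def tilt {d : ℕ} (r : ℝ) (N : E d) (ε : ℝ) (η : E (d + 1)) : ℝ :=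
  (r + ε * η (Fin.last d) - ε * inner ℝ ((ε / (2 * r)) • N) (horizontal η))
    / (1 + ‖(ε / (2 * r)) • N‖ ^ 2) / r

theorem continuous_tilt {d : ℕ} (r : ℝ) (N : E d) :
    Continuous fun q : ℝ × E (d + 1) => tilt r N q.1 q.2 := by
  have h : Continuous fun q : ℝ × E (d + 1) => horizontal q.2 :=
    (horizontalL d).continuous.comp continuous_snd
  unfold tilt
  refine Continuous.div_const (Continuous.div ?_ ?_ fun q => by positivity) r
  · fun_prop
  · fun_prop

theorem tilt_zero {d : ℕ} {r : ℝ} (hr : r ≠ 0) (N : E d) (η : E (d + 1)) : tilt r N 0 η = 1 := by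
  simp [tilt, hr]

theorem exists_rotation_tilt {d : ℕ} {r : ℝ} (hr : 0 < r) (N : E d) {ε : ℝ} (hε : 0 < ε) :
    ∃ (σ : Gr d) (V : E (d + 1) ≃ₗᵢ[ℝ] E (d + 1)), V ∈ rotationsTo σ ∧ ∀ η,
      ε⁻¹ • horizontal (V (projOnto σ (r • eLast d + ε • η)))
        = horizontal η + tilt r N ε η • N := by
  obtain ⟨σ, V, hV, h⟩ := exists_rotation ((ε / (2 * r)) • N)
  refine ⟨σ, V, hV, fun η => ?_⟩
  have h1 : horizontal (r • eLast d + ε • η) = ε • horizontal η := by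
    rw [← horizontalL_apply, map_add, map_smul, map_smul, horizontalL_apply, horizontalL_apply,
      horizontal_eLast, smul_zero, zero_add]
  have h2 : (r • eLast d + ε • η) (Fin.last d) = r + ε * η (Fin.last d) := by simp [eLast]
  rw [horizontal_rotation_projOnto hV, h, h1, h2, smul_add, inv_smul_smul₀ hε.ne', smul_smul,
    smul_smul, tilt]
  congr 2
  rw [inner_smul_right]
  field_simp

theorem ae_horizontal_add_ne_zero {d : ℕ} (hd : 1 ≤ d) (N : E d) :
    ∀ᵐ η : E (d + 1), horizontal η + N ≠ 0 := by
  have : NeZero d := ⟨by omega⟩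
  have h : {η : E (d + 1) | ¬ (horizontal η + N ≠ 0)}
      = splitLast d ⁻¹' ({-N} ×ˢ Set.univ) := by
    ext η
    simp [splitLast_apply, add_eq_zero_iff_eq_neg]
  rw [ae_iff, h, (measurePreserving_splitLast d).measure_preimage_equiv, Measure.volume_eq_prod,
    Measure.prod_prod]
  simp

/-- The limit of the rescaled operators. The multiplier `m` may be discontinuous at the origin,
which is why the limit of the integrands only holds almost everywhere. -/
theorem tendsto_integral_tilt {d : ℕ} (hd : 1 ≤ d) {m : E d → ℂ} (hm : ContinuousOn m {0}ᶜ)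
    {B : ℝ} (hB : ∀ η, ‖m η‖ ≤ B) {ζ : E (d + 1) → ℝ} (hζ : IsAnnularBump ζ) {r : ℝ} (hr : 0 < r)
    (φ : 𝓢(E d, ℂ)) (g : 𝓢(ℝ, ℂ)) (N : E d) (x : E (d + 1)) :
    Tendsto (fun ε : ℝ => ∫ η : E (d + 1), m (horizontal η + tilt r N ε η • N)
        * (ζ (r • eLast d + ε • η) * tensorLast (𝓕 φ) (𝓕 g) η) * char x η) (𝓝 0)
      (𝓝 (ζ (r • eLast d) * ((∫ η, 𝓕 φ η * m (η + N) * char η (horizontal x))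
        * g (x (Fin.last d))))) := by
  have hmm : Measurable m := measurable_of_continuousOn_compl_singleton 0 hm
  have hhor : Continuous (horizontal : E (d + 1) → E d) := (horizontalL d).continuous
  have hchar : Continuous fun ξ => char x ξ :=
    continuous_char.comp (by fun_prop : Continuous fun ξ : E (d + 1) => (x, ξ))
  obtain ⟨Z, hZ⟩ := hζ.hasCompactSupport.exists_bound_of_continuous hζ.smooth.continuous
  have hlim : (ζ (r • eLast d) : ℂ) * ((∫ η, 𝓕 φ η * m (η + N) * char η (horizontal x))
        * g (x (Fin.last d))) = ∫ η : E (d + 1), m (horizontal η + N)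
          * (ζ (r • eLast d) * tensorLast (𝓕 φ) (𝓕 g) η) * char x η := by
    have h1 : ∀ η, 𝓕 φ η * m (η + N) * char η (horizontal x)
        = (𝓕 φ η * m (η + N)) * char (horizontal x) η := fun η => by rw [char_comm]
    simp only [h1]
    rw [← integral_tensor_mul_char, ← integral_const_mul]
    refine integral_congr_ae (Eventually.of_forall fun η => ?_)
    simp only [tensorLast_apply]
    ring
  rw [hlim]
  refine tendsto_integral_filter_of_dominated_convergence
    (fun η => B * Z * ‖tensorLast (𝓕 φ) (𝓕 g) η‖) (Eventually.of_forall fun ε => ?_)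
    (Eventually.of_forall fun ε => Eventually.of_forall fun η => ?_)
    ((SchwartzMap.integrable _).norm.const_mul _) ?_
  · have ht : Continuous fun η => tilt r N ε η :=
      (continuous_tilt r N).comp (by fun_prop : Continuous fun η : E (d + 1) => (ε, η))
    refine Measurable.aestronglyMeasurable ((Measurable.mul ?_ ?_).mul hchar.measurable)
    · exact hmm.comp (by fun_prop : Continuous fun η : E (d + 1) =>
        horizontal η + tilt r N ε η • N).measurable
    · have := hζ.smooth.continuous
      have := (tensorLast (𝓕 φ) (𝓕 g)).continuous
      exact Continuous.measurable (by fun_prop)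
  · have hB0 : 0 ≤ B := (norm_nonneg _).trans (hB 0)
    rw [norm_mul, norm_char, mul_one, norm_mul, norm_mul, Complex.norm_real, mul_assoc]
    gcongr
    · exact hB _
    · exact hZ _
  · filter_upwards [ae_horizontal_add_ne_zero hd N] with η hη
    have ht : Tendsto (fun ε => horizontal η + tilt r N ε η • N) (𝓝 0) (𝓝 (horizontal η + N)) := by
      have h := ((continuous_tilt r N).comp
        (by fun_prop : Continuous fun ε : ℝ => (ε, η))).tendsto 0
      simp only [Function.comp_def, tilt_zero hr.ne'] at h
      simpa using (h.smul_const N).const_add (horizontal η)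
    have hmt := ((hm.continuousAt (isOpen_compl_singleton.mem_nhds hη)).tendsto).comp ht
    have hζt : Tendsto (fun ε : ℝ => ζ (r • eLast d + ε • η)) (𝓝 0) (𝓝 (ζ (r • eLast d))) := by
      have h : Continuous fun ε : ℝ => ζ (r • eLast d + ε • η) :=
        hζ.smooth.continuous.comp (by fun_prop)
      simpa using h.tendsto 0
    exact (hmt.mul (((Complex.continuous_ofReal.tendsto _).comp hζt).mul_const _)).mul_const _

/-- For each `ε` the integral over `η` is, up to a unimodular factor, the operator of one admissible
pair `(σ, V)` applied to the wave packet, at the point `x / ε`. -/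
theorem enorm_integral_tilt_le_maximalOp {d : ℕ} {m : E d → ℂ}
    {ζ : E (d + 1) → ℝ} (hζ : IsAnnularBump ζ) {r : ℝ} (hr : 0 < r)
    (φ : 𝓢(E d, ℂ)) (g : 𝓢(ℝ, ℂ)) (N : E d) (x : E (d + 1)) (K : ℝ) {ε : ℝ} (hε : 0 < ε) :
    ‖K‖ₑ * ‖∫ η : E (d + 1), m (horizontal η + tilt r N ε η • N)
        * (ζ (r • eLast d + ε • η) * tensorLast (𝓕 φ) (𝓕 g) η) * char x η‖ₑ
      ≤ maximalOp (fun _ η => (K : ℂ) * m (ε⁻¹ • η)) (annularProj ζ (wavePacket φ g r ε))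
        (ε⁻¹ • x) := by
  obtain ⟨σ, V, hV, h⟩ := exists_rotation_tilt hr N hε
  refine le_trans (le_of_eq (Eq.symm ?_)) (le_iSup_of_le σ (le_iSup₂_of_le V hV le_rfl))
  obtain ⟨q, hq, hqa⟩ := exists_fourier_annularProj hζ (wavePacket φ g r ε)
  rw [subspaceOp, hq, integral_eq_integral_add_smul _ (r • eLast d) hε]
  simp only [hqa, h, fourier_wavePacket_add_smul φ g r hε, char_add_right,
    char_smul_smul hε.ne']
  have h2 : ∀ η : E (d + 1), (K : ℂ) * m (horizontal η + tilt r N ε η • N)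
      * ((ζ (r • eLast d + ε • η) : ℂ)
        * ((((ε ^ (d + 1))⁻¹ : ℝ) : ℂ) * tensorLast (𝓕 φ) (𝓕 g) η))
      * (char (ε⁻¹ • x) (r • eLast d) * char x η)
      = ((((ε ^ (d + 1))⁻¹ : ℝ) : ℂ) * (K * char (ε⁻¹ • x) (r • eLast d)))
        * (m (horizontal η + tilt r N ε η • N)
        * (ζ (r • eLast d + ε • η) * tensorLast (𝓕 φ) (𝓕 g) η) * char x η) := fun η => by ring
  simp only [h2]
  rw [integral_const_mul, ← mul_assoc, ← mul_assoc, ← Complex.ofReal_mul,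
    mul_inv_cancel₀ (by positivity), Complex.ofReal_one, one_mul, enorm_mul, enorm_mul,
    ← ofReal_norm (char _ _), norm_char]
  simp only [ENNReal.ofReal_one, mul_one]
  congr 1
  rw [← ofReal_norm, ← ofReal_norm, Complex.norm_real]

/-- In the limit of wave packets of frequency width `ε → 0`, rotations that are `O(ε)`-close to the
identity act as the frequency shifts in the definition of the Carleson--Sjölin operator. -/
theorem carlesonSjolin_le_liminf_maximalOp {d : ℕ} (hd : 1 ≤ d) {m : E d → ℂ}
    (hm : ContinuousOn m {0}ᶜ) {B : ℝ} (hB : ∀ η, ‖m η‖ ≤ B) {ζ : E (d + 1) → ℝ}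
    (hζ : IsAnnularBump ζ) {r : ℝ} (hr : 0 < r) (φ : 𝓢(E d, ℂ)) (g : 𝓢(ℝ, ℂ)) (K : ℝ)
    {ε : ℕ → ℝ} (hε : ∀ j, 0 < ε j) (hε0 : Tendsto ε atTop (𝓝 0)) (x : E (d + 1)) :
    ‖K‖ₑ * ‖ζ (r • eLast d)‖ₑ * ‖g (x (Fin.last d))‖ₑ * carlesonSjolin m φ (horizontal x)
      ≤ liminf (fun j => maximalOp (fun _ η => (K : ℂ) * m ((ε j)⁻¹ • η))
        (annularProj ζ (wavePacket φ g r (ε j))) ((ε j)⁻¹ • x)) atTop := by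
  rw [carlesonSjolin, ENNReal.mul_iSup]
  refine iSup_le fun N => ?_
  have h := (ENNReal.Tendsto.const_mul (a := ‖K‖ₑ)
    ((tendsto_integral_tilt hd hm hB hζ hr φ g N x).enorm.comp hε0) (Or.inr enorm_ne_top)).liminf_eq
  have h2 : ‖K‖ₑ * ‖ζ (r • eLast d)‖ₑ * ‖g (x (Fin.last d))‖ₑ
      * ‖∫ η, 𝓕 φ η * m (η + N) * char η (horizontal x)‖ₑ
      = ‖K‖ₑ * ‖(ζ (r • eLast d) : ℂ) * ((∫ η, 𝓕 φ η * m (η + N) * char η (horizontal x))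
        * g (x (Fin.last d)))‖ₑ := by
    rw [enorm_mul, enorm_mul, ← ofReal_norm (ζ _ : ℂ), Complex.norm_real, ofReal_norm]
    ring
  refine (le_of_eq h2).trans ?_
  rw [← h]
  exact liminf_le_liminf (Eventually.of_forall fun j =>
    enorm_integral_tilt_le_maximalOp hζ hr φ g N x K (hε j))

/-- A Schwartz function on the line that is equal to `1` on `[0, 1]`. -/
theorem exists_schwartz_eq_one : ∃ g : 𝓢(ℝ, ℂ), ∀ s ∈ Set.Icc (0 : ℝ) 1, g s = 1 := by
  let b : ContDiffBump (0 : ℝ) := ⟨1, 2, one_pos, one_lt_two⟩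
  have hs : ContDiff ℝ ∞ (fun s => (b s : ℂ)) := Complex.ofRealCLM.contDiff.comp b.contDiff
  have hc : HasCompactSupport (fun s => (b s : ℂ)) :=
    b.hasCompactSupport.comp_left (g := ((↑) : ℝ → ℂ)) Complex.ofReal_zero
  refine ⟨hc.toSchwartzMap hs, fun s hs => ?_⟩
  have h1 : b s = 1 := b.one_of_mem_closedBall (by
    rw [Metric.mem_closedBall, Real.dist_eq, sub_zero, abs_of_nonneg hs.1]
    exact hs.2)
  change (b s : ℂ) = 1
  rw [h1, Complex.ofReal_one]

theorem IsAnnularBump.exists_ne_zero {d : ℕ} {ζ : E (d + 1) → ℝ} (hζ : IsAnnularBump ζ) :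
    ∃ r : ℝ, 0 < r ∧ ζ (r • eLast d) ≠ 0 := by
  obtain ⟨ξ, hξ⟩ := hζ.nontrivial
  have h := (hζ.supp (subset_tsupport _ hξ)).1
  refine ⟨‖ξ‖, by linarith, ?_⟩
  rwa [hζ.radial (‖ξ‖ • eLast d) ξ (by rw [norm_smul, norm_eLast]; simp)]

/-- The transference of a band-limited bound in `ℝ^{d+1}` to a bound in `ℝᵈ`. -/
theorem exists_carlesonSjolin_le {d A : ℕ} (hd : 1 ≤ d) {ζ : E (d + 1) → ℝ}
    (hζ : IsAnnularBump ζ) {p : ℝ} (hp : 0 < p) {ν : ∀ k : ℕ, (E k → ℝ≥0∞) → ℝ≥0∞}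
    (hν : IsLebesgueQuasinorm p ν) {C : ℝ≥0}
    (hC : ∀ m : Gr d → E d → ℂ, familyNorm A m ≤ 1 → ∀ f : 𝓢(E (d + 1), ℂ),
      ν (d + 1) (maximalOp m (annularProj ζ f)) ≤ C * eLpNorm f (ENNReal.ofReal p) volume) :
    ∃ C' : ℝ≥0, ∀ m : E d → ℂ, mihlinNorm A m < ⊤ → ∀ φ : 𝓢(E d, ℂ),
      ν d (carlesonSjolin m φ)
        ≤ C' * mihlinNorm A m * eLpNorm φ (ENNReal.ofReal p) volume := by
  obtain ⟨g, hg⟩ := exists_schwartz_eq_one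
  obtain ⟨r, hr, hζr⟩ := hζ.exists_ne_zero
  set G : ℝ≥0∞ := eLpNorm g (ENNReal.ofReal p) volume with hG
  have hGtop : G ≠ ⊤ := (g.memLp _ _).eLpNorm_ne_top
  refine ⟨‖ζ (r • eLast d)‖₊⁻¹ * C * G.toNNReal, fun m hm φ => ?_⟩
  obtain ⟨B, hB0, hB⟩ := exists_norm_le_of_mihlinNorm_lt_top hm
  have hmd := contDiffOn_of_mihlinNorm_lt_top hm
  have hmm := measurable_of_contDiffOn hmd
  set P : ℝ≥0∞ := eLpNorm φ (ENNReal.ofReal p) volume with hP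
  have hPtop : P ≠ ⊤ := (φ.memLp _ _).eLpNorm_ne_top
  set M : ℝ≥0 := (mihlinNorm A m).toNNReal with hM
  have hMm : mihlinNorm A m = M := (ENNReal.coe_toNNReal hm.ne).symm
  -- Normalizing by any number larger than the norm also covers multipliers of norm `0`.
  have key : ∀ L : ℝ≥0, M < L → ν d (carlesonSjolin m φ)
      ≤ (L * ‖ζ (r • eLast d)‖₊⁻¹ : ℝ≥0) * (C * (P * G)) := by
    intro L hL
    have hL0 : 0 < L := zero_le.trans_lt hL
    have hLe : ‖((L⁻¹ : ℝ≥0) : ℝ)‖ₑ = ((L⁻¹ : ℝ≥0) : ℝ≥0∞) := by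
      rw [Real.enorm_eq_ofReal (NNReal.coe_nonneg _), ENNReal.ofReal_coe_nnreal]
    have hε : ∀ j : ℕ, 0 < 1 / ((j : ℝ) + 1) := fun j => Nat.one_div_pos_of_nat
    set T : ℕ → E (d + 1) → ℝ≥0∞ := fun j => maximalOp
      (fun _ η => (((L⁻¹ : ℝ≥0) : ℝ) : ℂ) * m ((1 / ((j : ℝ) + 1))⁻¹ • η))
      (annularProj ζ (wavePacket φ g r (1 / ((j : ℝ) + 1)))) with hT
    have hfam : ∀ j : ℕ, familyNorm A (fun _ : Gr d => fun η : E d =>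
        (((L⁻¹ : ℝ≥0) : ℝ) : ℂ) * m ((1 / ((j : ℝ) + 1))⁻¹ • η)) ≤ 1 := fun j => by
      refine (familyNorm_const A _).trans ((mihlinNorm_mul_comp_smul_le hmd _
        (inv_pos.2 (hε j))).trans ?_)
      rw [hLe, hMm, ← ENNReal.coe_mul]
      refine ENNReal.coe_le_one_iff.2 ?_
      rw [inv_mul_le_iff₀ hL0, mul_one]
      exact hL.le
    have hTm : ∀ j, Measurable (T j) := fun j => by
      obtain ⟨q, hq, -⟩ := exists_fourier_annularProj hζ (wavePacket φ g r (1 / ((j : ℝ) + 1)))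
      refine measurable_maximalOp (B := ‖(((L⁻¹ : ℝ≥0) : ℝ) : ℂ)‖ * B) (fun _ => ?_)
        (fun _ η => ?_) (hq ▸ q.integrable)
      · exact (hmm.comp (measurable_const_smul _)).const_mul _
      · rw [norm_mul]
        gcongr
        exact hB _
    have hbound : ∀ j : ℕ, ν (d + 1) (fun x => T j ((1 / ((j : ℝ) + 1))⁻¹ • x))
        ≤ C * (P * G) := fun j => by
      refine (hν.comp_smul (T j) (hε j)).trans ?_
      refine (mul_le_mul_right (hC _ (hfam j) _) _).trans ?_
      rw [mul_left_comm]
      exact mul_le_mul_right (eLpNorm_wavePacket_le hp φ g r (hε j)) _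
    have hpt : ∀ x : E (d + 1), (Set.Icc (0 : ℝ) 1).indicator 1 (x (Fin.last d))
          * carlesonSjolin m φ (horizontal x)
        ≤ (L * ‖ζ (r • eLast d)‖₊⁻¹ : ℝ≥0)
          * liminf (fun j : ℕ => T j ((1 / ((j : ℝ) + 1))⁻¹ • x)) atTop := fun x => by
      by_cases hx : x (Fin.last d) ∈ Set.Icc (0 : ℝ) 1
      · have h := carlesonSjolin_le_liminf_maximalOp hd hmd.continuousOn hB hζ hr φ g
          ((L⁻¹ : ℝ≥0) : ℝ) hε tendsto_one_div_add_atTop_nhds_zero_nat x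
        refine le_trans (le_of_eq ?_) (mul_le_mul_right h _)
        have h2 : ‖ζ (r • eLast d)‖ₑ = (‖ζ (r • eLast d)‖₊ : ℝ≥0∞) := rfl
        rw [hg _ hx, hLe, h2, enorm_one, mul_one, ← mul_assoc, ← ENNReal.coe_mul,
          ← ENNReal.coe_mul]
        have h3 : L * ‖ζ (r • eLast d)‖₊⁻¹ * (L⁻¹ * ‖ζ (r • eLast d)‖₊) = 1 := by
          have : ‖ζ (r • eLast d)‖₊ ≠ 0 := by simpa using hζr
          field_simp
        rw [h3]
        simp [hx]
      · simp [hx]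
    calc ν d (carlesonSjolin m φ)
        ≤ _ := hν.slab _ (measurable_carlesonSjolin hmm hB φ)
      _ ≤ _ := hν.mono (Eventually.of_forall hpt)
      _ ≤ _ := hν.const_mul _ _
      _ ≤ _ := by
        refine mul_le_mul_right ((hν.fatou _ fun j => ?_).trans ?_) _
        · exact ((hTm j).comp (measurable_const_smul _)).aemeasurable
        · exact (liminf_le_liminf (Eventually.of_forall hbound)).trans (by simp)
  have hlim : Tendsto (fun L : ℝ≥0 => ((L * ‖ζ (r • eLast d)‖₊⁻¹ : ℝ≥0) : ℝ≥0∞) * (C * (P * G)))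
      (𝓝[>] M) (𝓝 ((M * ‖ζ (r • eLast d)‖₊⁻¹ : ℝ≥0) * (C * (P * G)))) := by
    refine ENNReal.Tendsto.mul_const ?_ (Or.inr (by finiteness))
    exact ENNReal.tendsto_coe.2
      (((tendsto_id.mul_const _).mono_left nhdsWithin_le_nhds))
  have h := ge_of_tendsto hlim (eventually_nhdsWithin_of_forall key)
  refine h.trans (le_of_eq ?_)
  rw [hMm, ENNReal.coe_mul, ENNReal.coe_mul, ENNReal.coe_mul, ENNReal.coe_toNNReal hGtop]
  ring

/-! ### Extension from Schwartz functions to Lebesgue spaces -/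

/-- A sequence of Schwartz functions that converges to `f` in `L^p` at a geometric rate; it is
constant if `f` is itself a Schwartz function. -/
theorem exists_schwartz_approx {k : ℕ} {p : ℝ≥0∞} (hp1 : 1 ≤ p) (hp : p ≠ ⊤) {f : E k → ℂ}
    (hf : MemLp f p volume) : ∃ φ : ℕ → 𝓢(E k, ℂ),
      (∀ j, eLpNorm ((φ j : E k → ℂ) - f) p volume ≤ (4⁻¹ : ℝ≥0∞) ^ j) ∧
      ∀ ψ : 𝓢(E k, ℂ), f = ψ → ∀ j, φ j = ψ := by
  by_cases h : ∃ ψ : 𝓢(E k, ℂ), f = ψ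
  · obtain ⟨ψ, rfl⟩ := h
    exact ⟨fun _ => ψ, fun j => by simp, fun ψ' h' _ => DFunLike.coe_injective h'⟩
  · have : ∀ j : ℕ, ∃ φ : 𝓢(E k, ℂ),
        eLpNorm ((φ : E k → ℂ) - f) p volume ≤ (4⁻¹ : ℝ≥0∞) ^ j := fun j => by
      obtain ⟨g, hg1, hg2, hg3⟩ := hf.exist_eLpNorm_sub_le hp hp1
        (show (0 : ℝ) < (4⁻¹) ^ j by positivity)
      refine ⟨hg1.toSchwartzMap hg2, ?_⟩
      have h1 : ENNReal.ofReal ((4⁻¹ : ℝ) ^ j) = (4⁻¹ : ℝ≥0∞) ^ j := by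
        rw [ENNReal.ofReal_pow (by norm_num), ENNReal.ofReal_inv_of_pos (by norm_num)]
        simp
      rw [← h1, eLpNorm_sub_comm]
      exact hg3
    choose φ hφ using this
    exact ⟨φ, hφ, fun ψ hψ => (h ⟨ψ, hψ⟩).elim⟩

theorem tendsto_inv_four_pow : Tendsto (fun j : ℕ => (4⁻¹ : ℝ≥0∞) ^ j) atTop (𝓝 0) :=
  ENNReal.tendsto_pow_atTop_nhds_zero_of_lt_one (ENNReal.inv_lt_one.2 (by norm_num))

/-- By the Borel--Cantelli lemma, a sequence of functions whose increments decay like `4^{-j}` in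
weak `L^p` converges almost everywhere. -/
theorem ae_exists_tendsto_of_weakNorm_le {k : ℕ} {p : ℝ} (hp : 1 ≤ p) (u : ℕ → E k → ℝ≥0)
    {C : ℝ≥0∞} (hC : C ≠ ⊤)
    (hu : ∀ j, weakNorm p (fun x => edist (u j x) (u (j + 1) x)) ≤ C * (4⁻¹ : ℝ≥0∞) ^ j) :
    ∀ᵐ x, ∃ a : ℝ≥0, Tendsto (fun j => u j x) atTop (𝓝 a) := by
  have hp0 : 0 < p := by linarith
  have hmeas : ∀ j : ℕ, volume {x | (((2⁻¹ : ℝ≥0) ^ j : ℝ≥0) : ℝ≥0∞) < edist (u j x) (u (j + 1) x)}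
      ≤ C ^ p * (2⁻¹ : ℝ≥0∞) ^ j := fun j => by
    set v := volume {x | (((2⁻¹ : ℝ≥0) ^ j : ℝ≥0) : ℝ≥0∞) < edist (u j x) (u (j + 1) x)}
    have h1 : (((2⁻¹ : ℝ≥0) ^ j : ℝ≥0) : ℝ≥0∞) * v ^ (1 / p) ≤ C * (4⁻¹ : ℝ≥0∞) ^ j :=
      (le_weakNorm p (fun x => edist (u j x) (u (j + 1) x)) ((2⁻¹ : ℝ≥0) ^ j)).trans (hu j)
    have h2 : (((2⁻¹ : ℝ≥0) ^ j : ℝ≥0) : ℝ≥0∞) = (2⁻¹ : ℝ≥0∞) ^ j := by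
      rw [ENNReal.coe_pow, ENNReal.coe_inv two_ne_zero]
      rfl
    have h4 : (4⁻¹ : ℝ≥0∞) = 2⁻¹ * 2⁻¹ := by
      rw [← ENNReal.mul_inv (by simp) (by simp)]
      norm_num
    have h20 : (2⁻¹ : ℝ≥0∞) ^ j ≠ 0 := pow_ne_zero _ (by simp)
    have h2t : (2⁻¹ : ℝ≥0∞) ^ j ≠ ⊤ := ENNReal.pow_ne_top (by simp)
    rw [h2, h4, mul_pow, mul_left_comm] at h1
    have h3 : v ^ (1 / p) ≤ C * (2⁻¹ : ℝ≥0∞) ^ j := (ENNReal.mul_le_mul_iff_right h20 h2t).1 h1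
    calc v = (v ^ (1 / p)) ^ p := by
          rw [← ENNReal.rpow_mul, one_div_mul_cancel hp0.ne', ENNReal.rpow_one]
      _ ≤ (C * (2⁻¹ : ℝ≥0∞) ^ j) ^ p := by gcongr
      _ = C ^ p * ((2⁻¹ : ℝ≥0∞) ^ j) ^ p := ENNReal.mul_rpow_of_nonneg _ _ hp0.le
      _ ≤ C ^ p * (2⁻¹ : ℝ≥0∞) ^ j := by
        gcongr
        refine ENNReal.rpow_le_self_of_le_one ?_ hp
        exact pow_le_one₀ (by simp) (ENNReal.inv_le_one.2 (by norm_num))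
  have hsum : ∑' j : ℕ, volume {x | (((2⁻¹ : ℝ≥0) ^ j : ℝ≥0) : ℝ≥0∞)
      < edist (u j x) (u (j + 1) x)} ≠ ⊤ := by
    refine ne_top_of_le_ne_top ?_ (ENNReal.tsum_le_tsum hmeas)
    rw [ENNReal.tsum_mul_left]
    refine ENNReal.mul_ne_top (ENNReal.rpow_ne_top_of_nonneg hp0.le hC) ?_
    rw [ENNReal.tsum_geometric]
    simp
  filter_upwards [ae_eventually_notMem hsum] with x hx
  obtain ⟨J, hJ⟩ := eventually_atTop.1 hx
  have hcauchy : CauchySeq fun n => u (n + J) x := by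
    refine cauchySeq_of_edist_le_geometric_two 2 (by simp) fun n => ?_
    have h1 : edist (u (n + J) x) (u (n + J + 1) x) ≤ (((2⁻¹ : ℝ≥0) ^ (n + J) : ℝ≥0) : ℝ≥0∞) :=
      not_lt.1 (hJ (n + J) (by omega))
    have h2 : n + 1 + J = n + J + 1 := by ring
    rw [h2]
    refine h1.trans ?_
    rw [ENNReal.coe_pow, ENNReal.coe_inv two_ne_zero, div_eq_mul_inv, ENNReal.inv_pow]
    calc ((2 : ℝ≥0) : ℝ≥0∞)⁻¹ ^ (n + J) ≤ ((2 : ℝ≥0) : ℝ≥0∞)⁻¹ ^ n :=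
          pow_le_pow_right_of_le_one' (ENNReal.inv_le_one.2 (by simp)) (by omega)
      _ ≤ 2 * 2⁻¹ ^ n := le_mul_of_one_le_left zero_le (by norm_num)
  obtain ⟨a, ha⟩ := cauchySeq_tendsto_of_complete hcauchy
  exact ⟨a, (tendsto_add_atTop_iff_nat J).1 ha⟩

/-- A bounded operator on Schwartz functions that is Lipschitz in the pointwise sense
`|T φ - T ψ| ≤ T (φ - ψ)` extends to `L^p`: along a rapidly convergent sequence of Schwartz
functions, its values converge almost everywhere. -/
theorem mapsLp_of_le {k : ℕ} {p : ℝ} (hp : 1 ≤ p) {ν : ∀ k : ℕ, (E k → ℝ≥0∞) → ℝ≥0∞}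
    (hν : IsLebesgueQuasinorm p ν) {T : (E k → ℂ) → E k → ℝ≥0∞}
    (hTm : ∀ φ : 𝓢(E k, ℂ), Measurable (T φ)) (hTtop : ∀ (φ : 𝓢(E k, ℂ)) (x), T φ x ≠ ⊤)
    (hTsub : ∀ (φ ψ : 𝓢(E k, ℂ)) (x),
      edist (T φ x).toNNReal (T ψ x).toNNReal ≤ T (φ - ψ : 𝓢(E k, ℂ)) x)
    {C : ℝ≥0∞} (hC : C ≠ ⊤)
    (hT : ∀ φ : 𝓢(E k, ℂ), ν k (T φ) ≤ C * eLpNorm φ (ENNReal.ofReal p) volume) :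
    MapsLp T (ENNReal.ofReal p) (ν k) C := by
  have hp0 : 0 < p := by linarith
  have hp1 : 1 ≤ ENNReal.ofReal p := by simpa using hp
  have happrox : ∀ f : E k → ℂ, ∃ φ : ℕ → 𝓢(E k, ℂ), MemLp f (ENNReal.ofReal p) volume →
      (∀ j, eLpNorm ((φ j : E k → ℂ) - f) (ENNReal.ofReal p) volume ≤ (4⁻¹ : ℝ≥0∞) ^ j) ∧
        ∀ ψ : 𝓢(E k, ℂ), f = ψ → ∀ j, φ j = ψ := fun f => by
    by_cases hf : MemLp f (ENNReal.ofReal p) volume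
    · obtain ⟨φ, hφ⟩ := exists_schwartz_approx hp1 ENNReal.ofReal_ne_top hf
      exact ⟨φ, fun _ => hφ⟩
    · exact ⟨fun _ => 0, fun h => (hf h).elim⟩
  choose Φ hΦ using happrox
  set U : 𝓢(E k, ℂ) → E k → ℝ≥0 := fun φ x => (T φ x).toNNReal with hU
  have hUT : ∀ φ x, (U φ x : ℝ≥0∞) = T φ x := fun φ x => ENNReal.coe_toNNReal (hTtop φ x)
  have hUm : ∀ φ, Measurable (U φ) := fun φ => (hTm φ).ennreal_toNNReal
  -- The distance between approximants of two functions.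
  have hdist : ∀ {f g : E k → ℂ}, MemLp f (ENNReal.ofReal p) volume →
      MemLp g (ENNReal.ofReal p) volume → ∀ i j : ℕ,
      eLpNorm (Φ f i - Φ g j : 𝓢(E k, ℂ)) (ENNReal.ofReal p) volume
        ≤ eLpNorm (f - g) (ENNReal.ofReal p) volume + ((4⁻¹ : ℝ≥0∞) ^ i + (4⁻¹ : ℝ≥0∞) ^ j) := by
    intro f g hf hg i j
    have hsplit : ((Φ f i - Φ g j : 𝓢(E k, ℂ)) : E k → ℂ)
        = (f - g) + (((Φ f i : E k → ℂ) - f) + (g - (Φ g j : E k → ℂ))) := by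
      ext x
      simp only [sub_apply, Pi.add_apply, Pi.sub_apply]
      ring
    have m1 := ((Φ f i).memLp (ENNReal.ofReal p) volume).1.sub hf.1
    have m2 := hg.1.sub ((Φ g j).memLp (ENNReal.ofReal p) volume).1
    rw [hsplit]
    refine (eLpNorm_add_le (hf.1.sub hg.1) (m1.add m2) hp1).trans ?_
    gcongr
    refine (eLpNorm_add_le m1 m2 hp1).trans ?_
    gcongr
    · exact (hΦ f hf).1 i
    · rw [eLpNorm_sub_comm]
      exact (hΦ g hg).1 j
  have hdist_lim : ∀ f g : E k → ℂ, Tendsto (fun j : ℕ =>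
      C * (eLpNorm (f - g) (ENNReal.ofReal p) volume + ((4⁻¹ : ℝ≥0∞) ^ j + (4⁻¹ : ℝ≥0∞) ^ j)))
      atTop (𝓝 (C * eLpNorm (f - g) (ENNReal.ofReal p) volume)) := fun f g => by
    have h := ENNReal.Tendsto.const_mul (a := C)
      ((tendsto_inv_four_pow.add tendsto_inv_four_pow).const_add
        (eLpNorm (f - g) (ENNReal.ofReal p) volume)) (Or.inr hC)
    simpa using h
  have hconv : ∀ f, MemLp f (ENNReal.ofReal p) volume →
      ∀ᵐ x, Tendsto (fun j => U (Φ f j) x) atTop (𝓝 (limUnder atTop fun j => U (Φ f j) x)) := by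
    intro f hf
    have h := ae_exists_tendsto_of_weakNorm_le hp (fun j => U (Φ f j)) (C := C * 2)
      (ENNReal.mul_ne_top hC (by simp)) fun j => by
        have hm : AEMeasurable (fun x => edist (U (Φ f j) x) (U (Φ f (j + 1)) x)) volume :=
          ((hUm _).edist (hUm _)).aemeasurable
        refine (hν.weakNorm_le _ hm).trans ((hν.mono (Eventually.of_forall
          fun x => hTsub (Φ f j) (Φ f (j + 1)) x)).trans ((hT _).trans ?_))
        rw [mul_assoc]
        gcongr
        refine (hdist hf hf j (j + 1)).trans ?_
        rw [sub_self, eLpNorm_zero, zero_add, two_mul]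
        have h4 : (4⁻¹ : ℝ≥0∞) ≤ 1 := ENNReal.inv_le_one.2 (by norm_num)
        exact add_le_add le_rfl <| pow_le_pow_right_of_le_one' h4 (Nat.le_succ j)
    filter_upwards [h] with x hx
    exact tendsto_nhds_limUnder hx
  have hdiff : ∀ f g, MemLp f (ENNReal.ofReal p) volume → MemLp g (ENNReal.ofReal p) volume →
      ν k (fun x => edist (limUnder atTop fun j => U (Φ f j) x)
        (limUnder atTop fun j => U (Φ g j) x)) ≤ C * eLpNorm (f - g) (ENNReal.ofReal p) volume := by
    intro f g hf hg
    have h1 : ∀ᵐ x, edist (limUnder atTop fun j => U (Φ f j) x)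
        (limUnder atTop fun j => U (Φ g j) x)
          ≤ liminf (fun j => T (Φ f j - Φ g j : 𝓢(E k, ℂ)) x) atTop := by
      filter_upwards [hconv f hf, hconv g hg] with x hx hy
      rw [← (hx.edist hy).liminf_eq]
      exact liminf_le_liminf (Eventually.of_forall fun j => hTsub _ _ x)
    refine (hν.mono h1).trans ((hν.fatou _ fun j => (hTm _).aemeasurable).trans ?_)
    rw [← (hdist_lim f g).liminf_eq]
    refine liminf_le_liminf (Eventually.of_forall fun j => (hT _).trans ?_)
    gcongr
    exact hdist hf hg j j
  refine ⟨fun f x => limUnder atTop fun j => U (Φ f j) x, fun φ => ?_, fun f hf => ?_,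
    fun f hf => ?_, hdiff⟩
  · refine Eventually.of_forall fun x => ?_
    have h := (hΦ φ (φ.memLp _ _)).2 φ rfl
    simp only [h]
    rw [tendsto_const_nhds.limUnder_eq, hUT]
  · exact aemeasurable_of_tendsto_metrizable_ae atTop (fun j => (hUm (Φ f j)).aemeasurable)
      (hconv f hf)
  · have h1 : ∀ᵐ x, ((limUnder atTop fun j => U (Φ f j) x : ℝ≥0) : ℝ≥0∞)
        ≤ liminf (fun j => T (Φ f j) x) atTop := by
      filter_upwards [hconv f hf] with x hx
      have h2 := ((ENNReal.continuous_coe.tendsto _).comp hx).liminf_eq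
      simp only [Function.comp_def, hUT] at h2
      exact h2.ge
    refine (hν.mono h1).trans ((hν.fatou _ fun j => (hTm _).aemeasurable).trans ?_)
    have h3 := hdist_lim f 0
    rw [sub_zero] at h3
    rw [← h3.liminf_eq]
    refine liminf_le_liminf (Eventually.of_forall fun j => (hT _).trans ?_)
    gcongr
    have h4 := hdist hf (MemLp.zero' (ε := ℂ)) j j
    have h5 : Φ (fun _ => 0) j = 0 := (hΦ (fun _ => 0) MemLp.zero').2 0 rfl j
    rw [h5, sub_zero] at h4
    exact h4.trans (le_of_eq (by rw [show f - (fun _ => 0) = f from sub_zero f]))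

/-! ### The Carleson--Sjölin operator -/

theorem carlesonSjolin_ne_top {d : ℕ} {m : E d → ℂ} {B : ℝ} (hB : ∀ η, ‖m η‖ ≤ B)
    (f : 𝓢(E d, ℂ)) (x : E d) : carlesonSjolin m f x ≠ ⊤ := by
  have h : carlesonSjolin m f x ≤ ENNReal.ofReal B * ∫⁻ η, ‖𝓕 f η‖ₑ := by
    refine iSup_le fun N => (enorm_integral_le_lintegral_enorm _).trans ?_
    rw [← lintegral_const_mul' _ _ ENNReal.ofReal_ne_top]
    refine lintegral_mono fun η => ?_
    rw [enorm_mul, enorm_mul, ← ofReal_norm (char _ _), norm_char, ENNReal.ofReal_one, mul_one,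
      mul_comm, ← ofReal_norm (m _)]
    exact mul_le_mul_left (ENNReal.ofReal_le_ofReal (hB _)) _
  exact ne_top_of_le_ne_top (ENNReal.mul_ne_top ENNReal.ofReal_ne_top
    (𝓕 f).integrable.2.ne) h

theorem carlesonSjolin_le_add {d : ℕ} {m : E d → ℂ} (hm : Measurable m) {B : ℝ}
    (hB : ∀ η, ‖m η‖ ≤ B) (f g : 𝓢(E d, ℂ)) (x : E d) :
    carlesonSjolin m f x ≤ carlesonSjolin m g x + carlesonSjolin m (f - g : 𝓢(E d, ℂ)) x := by
  have hint : ∀ (φ : 𝓢(E d, ℂ)) (N : E d),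
      Integrable (fun η => 𝓕 φ η * m (η + N) * char η x) volume := fun φ N => by
    have hchar : Continuous fun η => char η x :=
      continuous_char.comp (by fun_prop : Continuous fun η : E d => (η, x))
    have h := integrable_mul_of_norm_le (b := fun η => char η x * m (η + N)) (B := 1 * B)
      (hchar.measurable.mul (hm.comp (measurable_add_const N)))
      (fun η => by
        rw [norm_mul, norm_char]
        gcongr
        exact hB _) (𝓕 φ).integrable
    refine h.congr (Eventually.of_forall fun η => ?_)
    simp only
    ring
  refine iSup_le fun N => ?_
  have hsplit : ∫ η, 𝓕 f η * m (η + N) * char η x = (∫ η, 𝓕 g η * m (η + N) * char η x)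
      + ∫ η, 𝓕 (f - g) η * m (η + N) * char η x := by
    rw [← integral_add (hint g N) (hint (f - g) N)]
    refine integral_congr_ae (Eventually.of_forall fun η => ?_)
    have h : 𝓕 (f - g) = 𝓕 f - 𝓕 g := by
      rw [eq_sub_iff_add_eq, ← FourierTransform.fourier_add (f - g) g, sub_add_cancel]
    simp only [h, sub_apply]
    ring
  refine (congrArg _ hsplit).le.trans ((enorm_add_le _ _).trans ?_)
  exact add_le_add (le_iSup (fun N => ‖∫ η, 𝓕 g η * m (η + N) * char η x‖ₑ) N)
    (le_iSup (fun N => ‖∫ η, 𝓕 (f - g) η * m (η + N) * char η x‖ₑ) N)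

theorem carlesonSjolin_sub_comm {d : ℕ} (m : E d → ℂ) (f g : 𝓢(E d, ℂ)) (x : E d) :
    carlesonSjolin m (f - g : 𝓢(E d, ℂ)) x = carlesonSjolin m (g - f : 𝓢(E d, ℂ)) x := by
  refine iSup_congr fun N => ?_
  have h : 𝓕 (f - g) = - 𝓕 (g - f) := by
    refine eq_neg_of_add_eq_zero_left ?_
    rw [← FourierTransform.fourier_add (f - g) (g - f), sub_add_sub_cancel, sub_self,
      FourierTransform.fourier_zero]
  have h2 : ∀ η, 𝓕 ((f - g : 𝓢(E d, ℂ)) : E d → ℂ) η * m (η + N) * char η x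
      = -(𝓕 ((g - f : 𝓢(E d, ℂ)) : E d → ℂ) η * m (η + N) * char η x) := fun η => by
    rw [← SchwartzMap.fourier_coe, ← SchwartzMap.fourier_coe, h]
    simp
  simp only [h2]
  rw [integral_neg, enorm_neg]

theorem edist_carlesonSjolin_le {d : ℕ} {m : E d → ℂ} (hm : Measurable m) {B : ℝ}
    (hB : ∀ η, ‖m η‖ ≤ B) (f g : 𝓢(E d, ℂ)) (x : E d) :
    edist (carlesonSjolin m f x).toNNReal (carlesonSjolin m g x).toNNReal
      ≤ carlesonSjolin m (f - g : 𝓢(E d, ℂ)) x := by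
  have h1 := carlesonSjolin_le_add hm hB f g x
  have h2 := carlesonSjolin_le_add hm hB g f x
  rw [carlesonSjolin_sub_comm] at h2
  lift carlesonSjolin m f x to ℝ≥0 using carlesonSjolin_ne_top hB f x with a
  lift carlesonSjolin m g x to ℝ≥0 using carlesonSjolin_ne_top hB g x with b
  lift carlesonSjolin m (f - g : 𝓢(E d, ℂ)) x to ℝ≥0 using carlesonSjolin_ne_top hB _ x with c
  rw [ENNReal.toNNReal_coe, ENNReal.toNNReal_coe, edist_nndist, NNReal.nndist_eq]
  norm_cast at h1 h2 ⊢
  exact max_le (tsub_le_iff_left.2 h1) (tsub_le_iff_left.2 h2)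

/-- The bound on Schwartz functions and the extension, for a general quasi-norm. -/
theorem exists_carlesonSjolin_le_and_mapsLp {d A : ℕ} (hd : 1 ≤ d) {ζ : E (d + 1) → ℝ}
    (hζ : IsAnnularBump ζ) {p : ℝ} (hp : 1 ≤ p) {ν : ∀ k : ℕ, (E k → ℝ≥0∞) → ℝ≥0∞}
    (hν : IsLebesgueQuasinorm p ν)
    (h : ∃ C : ℝ≥0, ∀ m : Gr d → E d → ℂ, familyNorm A m ≤ 1 → ∀ f : 𝓢(E (d + 1), ℂ),
      ν (d + 1) (maximalOp m (annularProj ζ f)) ≤ C * eLpNorm f (ENNReal.ofReal p) volume) :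
    ∃ C : ℝ≥0, ∀ m : E d → ℂ, mihlinNorm A m < ⊤ →
      (∀ φ : 𝓢(E d, ℂ), ν d (carlesonSjolin m φ)
        ≤ C * mihlinNorm A m * eLpNorm φ (ENNReal.ofReal p) volume) ∧
      MapsLp (carlesonSjolin m) (ENNReal.ofReal p) (ν d) (C * mihlinNorm A m) := by
  obtain ⟨C, hC⟩ := h
  obtain ⟨C', hC'⟩ := exists_carlesonSjolin_le hd hζ (by linarith) hν hC
  refine ⟨C', fun m hm => ⟨hC' m hm, ?_⟩⟩
  obtain ⟨B, -, hB⟩ := exists_norm_le_of_mihlinNorm_lt_top hm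
  have hmm := measurable_of_contDiffOn (contDiffOn_of_mihlinNorm_lt_top hm)
  exact mapsLp_of_le hp hν (measurable_carlesonSjolin hmm hB) (carlesonSjolin_ne_top hB)
    (edist_carlesonSjolin_le hmm hB) (ENNReal.mul_ne_top ENNReal.coe_ne_top hm.ne) (hC' m hm)

end CarlesonSjolin

theorem mainTheorem4 (d : ℕ) (hd : 1 ≤ d) (A : ℕ)
    (ζ : CarlesonSjolin.E (d + 1) → ℝ) (hζ : CarlesonSjolin.IsAnnularBump ζ)
    (hmain : CarlesonSjolin.BandLimitedBounds d A ζ) :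
    (∃ C : ℝ≥0, ∀ m : CarlesonSjolin.E d → ℂ, CarlesonSjolin.mihlinNorm A m < ⊤ →
      (∀ φ : 𝓢(CarlesonSjolin.E d, ℂ),
        CarlesonSjolin.weakNorm 2 (CarlesonSjolin.carlesonSjolin m φ)
          ≤ C * CarlesonSjolin.mihlinNorm A m * eLpNorm φ 2 volume) ∧
      CarlesonSjolin.MapsLp (CarlesonSjolin.carlesonSjolin m) 2
        (CarlesonSjolin.weakNorm 2) (C * CarlesonSjolin.mihlinNorm A m)) ∧
    (∀ p : ℝ, 2 < p →
      ∃ C : ℝ≥0, ∀ m : CarlesonSjolin.E d → ℂ, CarlesonSjolin.mihlinNorm A m < ⊤ →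
        (∀ φ : 𝓢(CarlesonSjolin.E d, ℂ),
          eLpNorm (CarlesonSjolin.carlesonSjolin m φ) (ENNReal.ofReal p) volume
            ≤ C * CarlesonSjolin.mihlinNorm A m * eLpNorm φ (ENNReal.ofReal p) volume) ∧
        CarlesonSjolin.MapsLp (CarlesonSjolin.carlesonSjolin m) (ENNReal.ofReal p)
          (fun g => eLpNorm g (ENNReal.ofReal p) volume)
          (C * CarlesonSjolin.mihlinNorm A m)) := by
  refine ⟨?_, fun p hp => ?_⟩
  · have h := CarlesonSjolin.exists_carlesonSjolin_le_and_mapsLp (A := A) hd hζ (p := 2)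
      (by norm_num) (CarlesonSjolin.isLebesgueQuasinorm_weakNorm two_pos)
    rw [ENNReal.ofReal_ofNat] at h
    exact h hmain.1
  · exact CarlesonSjolin.exists_carlesonSjolin_le_and_mapsLp hd hζ (by linarith)
      (CarlesonSjolin.isLebesgueQuasinorm_eLpNorm (by linarith)) (hmain.2 p hp)
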